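/- **Theorem (oracle inequalities of the nodewise regressions).** Let $\Sigma_0\in\mathbb R^{p\times p}$ be symmetric positive definite with $\Sigma_{0,ii}=1$ for all $i$, let $\Theta_0=(\theta_{0,ij})=\Sigma_0^{-1}$, and let $X$ be the $n\times p$ matrix whose rows $X^{(1)},\dots,X^{(n)}$ are i.i.d. $\mathcal N_p(0,\Sigma_0)$, with columns $X_1,\dots,X_p$. For each $i$ put $\beta^i_j=-\theta_{0,ij}/\theta_{0,ii}$ $(j\ne i)$, $V_i=X_i-\sum_{j\neq i}\beta^i_jX_j$ and $\sigma_{V_i}^2=\mathrm{Var}(V_i)=1/\theta_{0,ii}$. Let $\lambda=\sqrt{2\log p/n}$. Let $s^i=\#\{j\ne i:\theta_{0,ij}\ne0\}$, $s=\max_is^i$ (so $s<p$), let $s_0^i$ be the smallest integer with $\sum_{j\ne i}\min\{(\beta^i_j)^2,\lambda^2\sigma_{V_i}^2\}\le s_0^i\lambda^2\sigma_{V_i}^2$, and let $s_0=\max_is_0^i$. *Eigenvalue notions.* For a function $q$ on $\mathbb R^p$, namely $q(\upsilon)=\|\Sigma_0^{1/2}\upsilon\|_2$ (written "for $\Sigma_0$")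 or $q(\upsilon)=\|X\upsilon\|_2/\sqrt n$ ("for $X$"), let $$\frac1{K(s_0,k_0,\cdot)}=\min_{|J|\le s_0}\ \min_{\upsilon\ne0,\ \|\upsilon_{J^c}\|_1\le k_0\|\upsilon_J\|_1}\frac{q(\upsilon)}{\|\upsilon_J\|_2};$$ $RE(s_0,k_0,\cdot)$ means that $1\le s_0<p$ and that this minimum is positive. Let $\rho_{\min}(m),\rho_{\max}(m)$ (for $\Sigma_0$) and $\Lambda_{\min}(m),\Lambda_{\max}(m)$ (for $X$) be the minimum and maximum of $q(\upsilon)^2/\|\upsilon\|_2^2$ over nonzero $\upsilon$ with at most $m$ nonzero entries, with $\rho_{\max}(0)=0$. Write $K=K(s_0,4,\Sigma_0)$. *Assumptions.* Let $0<\theta<1$, $\rho_{\min}(s)>0$, $\rho_{\max}(\max(s,3s_0))<\infty$, suppose $RE(s_0,4,\Sigma_0)$ holds, and suppose that, for some positive numbers $c',\alpha$ (the result holds for every choice of them), $$n>\max\Bigl\{\tfrac{9c'\alpha^4}{\theta^2}\max\bigl(36K^2f(s_0),\log p\bigr),\ \tfrac{80s\alpha^4}{\theta^2}\log\tfrac{5ep}{s\theta}\Bigr\},\qquad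 f(s_0)=\min\bigl(4s_0\rho_{\max}(s_0)\log(5ep/s_0),\,s_0\log p\bigr).$$ Let $a\ge6$, $d_0\ge2(1+\theta)\sqrt{1+a}$, $\lambda_n=d_0\lambda$. *Events.* Let $\mathcal C_a=\{|\tfrac1n\langle V_j/\sigma_{V_j},X_k\rangle|<\sqrt{1+a}\,\lambda\ \ \forall j\neq k\}$ and $\mathcal X=\mathcal R\cap\mathcal F\cap\mathcal M$, where $\mathcal F=\{1-\theta\le\|X_j\|_2/\sqrt n\le1+\theta\ \forall j\}$, $\mathcal R=\{RE(s_0,4,X)\text{ holds and }0<K(s_0,4,X)\le K/(1-\theta)\}$, and $\mathcal M$ is the event that $0<(1-\theta)\sqrt{\rho_{\min}(m)}\le\sqrt{\Lambda_{\min}(m)}\le\sqrt{\Lambda_{\max}(m)}\le(1+\theta)\sqrt{\rho_{\max}(m)}$ for all integers $1\le m\le\max(s,5s_0)$. *Constants.* For each $i$, with $k=s_0^i$, let $$D^i=\frac{3(1+\theta)\sqrt{\rho_{\max}(s-k)}}{(1-\theta)\sqrt{\rho_{\min}(2k)}}+\frac{2(1+\theta)^4\rho_{\max}(3k)\rho_{\max}(s-k)}{d_0(1-\theta)^2\rho_{\min}(2k)},$$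 $$D_0^i=\max\Bigl\{\frac{D^i}{d_0},\ \frac{2\sqrt2(1+\theta)K\sqrt{\rho_{\max}(s-k)}}{(1-\theta)d_0}+\frac{3\sqrt2K^2}{(1-\theta)^2}\Bigr\},$$ $$D_1^i=\max\Bigl\{\frac{4(1+\theta)^2\rho_{\max}(s-k)}{d_0^2},\ \Bigl(\frac{(1+\theta)\sqrt{\rho_{\max}(s-k)}}{d_0}+\frac{3K}{2(1-\theta)}\Bigr)^2\Bigr\}.$$ (If $k=0$, the values of $D_0^i$ and $D_1^i$ are immaterial: the right-hand sides below are $0$.) *Conclusion.* On $\mathcal C_a\cap\mathcal X$ the following holds simultaneously for all $i=1,\dots,p$. Let $\beta^i_{\rm init}$ be any minimizer of $$\frac1{2n}\sum_{r=1}^n\Bigl(X_i^{(r)}-\sum_{j\ne i}b_jX_j^{(r)}\Bigr)^2+\lambda_n\sum_{j\ne i}|b_j|$$ over $b\in\mathbb R^{\{j\ne i\}}$, let $T_0$ be any set of locations of the $s_0^i$ largest entries of $\beta^i$ in absolute value, let $h^i=\beta^i_{\rm init}-\beta^i_{T_0}$ (where $\beta^i_{T_0}$ is $\beta^i$ set to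 zero outside $T_0$), let $T_1$ be any set of locations of the $s_0^i$ largest entries of $h^i$ in absolute value outside $T_0$ (all of $T_0^c$ if it has fewer elements), and $T_{01}=T_0\cup T_1$. Then $$\|\beta^i_{\rm init}-\beta^i\|_2\le\lambda\sqrt{s_0^i}\,d_0\sqrt{2(D^i_0)^2+2(D^i_1)^2+2},$$ $$\|h^i_{T_{01}}\|_2\le D^i_0d_0\lambda\sqrt{s_0^i},\qquad\|h^i_{T_0^c}\|_1=\|\beta^i_{{\rm init},T_0^c}\|_1\le D^i_1d_0\lambda s_0^i.$$ -/

import Mathlib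

open MeasureTheory ProbabilityTheory

noncomputable section

namespace NodewiseLasso

/-! ### Norms on index sets -/

section Vectors

variable {ι : Type*}

/-- `‖v_J‖₁`. -/
def l1On (J : Finset ι) (v : ι → ℝ) : ℝ := ∑ j ∈ J, |v j|

/-- `‖v_J‖₂`. -/
def l2On (J : Finset ι) (v : ι → ℝ) : ℝ := √(∑ j ∈ J, v j ^ 2)

/-- `T` is a set of locations of the `k` largest entries of `v` in absolute value among the
locations in `A` (all of `A` if `A` has fewer than `k` elements). Ties may be broken arbitrarily. -/
def IsLargestOn (A : Finset ι) (k : ℕ) (v : ι → ℝ) (T : Finset ι) : Prop :=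
  T ⊆ A ∧ T.card = min k A.card ∧ ∀ j ∈ T, ∀ l ∈ A, l ∉ T → |v l| ≤ |v j|

/-- The vector that agrees with `v` on `T` and vanishes elsewhere. -/
def restrictTo [DecidableEq ι] (T : Finset ι) (v : ι → ℝ) : ι → ℝ :=
  fun j => if j ∈ T then v j else 0

end Vectors

/-! ### Restricted and sparse eigenvalues

Both are defined for a seminorm-like function `q` on `ℝᵖ`, which is `υ ↦ ‖Σ₀^{1/2} υ‖₂` for a
covariance matrix and `υ ↦ ‖X υ‖₂ / √n` for a design matrix. -/

variable {p n : ℕ}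

/-- `‖S^{1/2} υ‖₂ = √(υᵀ S υ)` for a positive semidefinite matrix `S`. -/
def covSize (S : Matrix (Fin p) (Fin p) ℝ) (v : Fin p → ℝ) : ℝ :=
  √(v ⬝ᵥ (S.mulVec v))

/-- `‖X υ‖₂ / √n` for an `n × p` design matrix `X`. -/
def designSize (X : Matrix (Fin n) (Fin p) ℝ) (v : Fin p → ℝ) : ℝ :=
  l2On Finset.univ (X.mulVec v) / √(n : ℝ)

/-- The quotients `q(υ) / ‖υ_J‖₂` over all `|J| ≤ s₀` and `υ ≠ 0` with
`‖υ_{Jᶜ}‖₁ ≤ k₀ ‖υ_J‖₁`. -/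
def reRatios (q : (Fin p → ℝ) → ℝ) (s₀ : ℕ) (k₀ : ℝ) : Set ℝ :=
  {r | ∃ J : Finset (Fin p), J.card ≤ s₀ ∧ ∃ v : Fin p → ℝ, v ≠ 0 ∧
    l1On Jᶜ v ≤ k₀ * l1On J v ∧ r = q v / l2On J v}

/-- The constant `K(s₀, k₀, ·)` : its inverse is the minimum of the quotients. -/
def reConst (q : (Fin p → ℝ) → ℝ) (s₀ : ℕ) (k₀ : ℝ) : ℝ := (sInf (reRatios q s₀ k₀))⁻¹

/-- The restricted eigenvalue condition `RE(s₀, k₀, ·)`, for an integer `1 ≤ s₀ < p`. -/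
def RE (q : (Fin p → ℝ) → ℝ) (s₀ : ℕ) (k₀ : ℝ) : Prop :=
  1 ≤ s₀ ∧ s₀ < p ∧ 0 < sInf (reRatios q s₀ k₀)

/-- The quotients `q(υ)² / ‖υ‖₂²` over the nonzero `m`-sparse vectors (those with at most `m`
nonzero entries). -/
def sparseRatios (q : (Fin p → ℝ) → ℝ) (m : ℕ) : Set ℝ :=
  {r | ∃ v : Fin p → ℝ, v ≠ 0 ∧ (Finset.univ.filter (fun j => v j ≠ 0)).card ≤ m ∧
    r = q v ^ 2 / l2On Finset.univ v ^ 2}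

/-- Smallest `m`-sparse eigenvalue. -/
def sparseMin (q : (Fin p → ℝ) → ℝ) (m : ℕ) : ℝ := sInf (sparseRatios q m)

/-- Largest `m`-sparse eigenvalue (it is `0` for `m = 0`, where there is no nonzero vector). -/
def sparseMax (q : (Fin p → ℝ) → ℝ) (m : ℕ) : ℝ := sSup (sparseRatios q m)

/-! ### The graphical model and its nodewise regressions

`S` is the covariance matrix `Σ₀`, and `Θ₀ = S⁻¹` is the precision matrix. -/

/-- `λ = √(2 log p / n)`. -/
def lam (p n : ℕ) : ℝ := √(2 * Real.log p / n)

/-- The degree `sⁱ` of node `i` in the conditional independence graph: the number of nonzero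
off-diagonal entries of row `i` of `Θ₀`. -/
def nodeDegree (S : Matrix (Fin p) (Fin p) ℝ) (i : Fin p) : ℕ :=
  (Finset.univ.filter (fun j => j ≠ i ∧ S⁻¹ i j ≠ 0)).card

/-- The maximum node degree `s`. -/
def maxNodeDegree (S : Matrix (Fin p) (Fin p) ℝ) : ℕ :=
  Finset.univ.sup (nodeDegree S)

/-- The index set of the covariates in the regression of `X_i` on the other variables. -/
abbrev Others (i : Fin p) : Type := {j : Fin p // j ≠ i}

/-- The regression coefficients `βⁱ_j = - θ_{ij} / θ_{ii}`, `j ≠ i`. -/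
def coef (S : Matrix (Fin p) (Fin p) ℝ) (i : Fin p) : Others i → ℝ :=
  fun j => - S⁻¹ i j / S⁻¹ i i

/-- `Var(V_i) = 1 / θ_{ii}`. -/
def noiseVar (S : Matrix (Fin p) (Fin p) ℝ) (i : Fin p) : ℝ := 1 / S⁻¹ i i

/-- The noise vector `V_i = X_i - ∑_{j ≠ i} βⁱ_j X_j` of the `i`-th regression, as a function of
the design matrix. -/
def noise (S : Matrix (Fin p) (Fin p) ℝ) (X : Matrix (Fin n) (Fin p) ℝ) (i : Fin p) (r : Fin n) :
    ℝ :=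
  X r i - ∑ j : Others i, coef S i j * X r j

/-- Essential sparsity `s₀ⁱ` of the `i`-th regression: the smallest integer `k` with
`∑_{j ≠ i} min((βⁱ_j)², λ² Var(V_i)) ≤ k λ² Var(V_i)`. -/
def essSparsity (S : Matrix (Fin p) (Fin p) ℝ) (n : ℕ) (i : Fin p) : ℕ :=
  sInf {k : ℕ | ∑ j : Others i, min (coef S i j ^ 2) (lam p n ^ 2 * noiseVar S i) ≤
    k * (lam p n ^ 2 * noiseVar S i)}

/-- `s₀ = max_i s₀ⁱ`. -/
def maxEssSparsity (S : Matrix (Fin p) (Fin p) ℝ) (n : ℕ) : ℕ :=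
  Finset.univ.sup (essSparsity S n)

/-- The Lasso objective
`(1/(2n)) ∑_r (X_i^{(r)} - ∑_{j ≠ i} b_j X_j^{(r)})² + λ_n ∑_{j ≠ i} |b_j|` of the `i`-th
regression. -/
def lassoObjective (X : Matrix (Fin n) (Fin p) ℝ) (i : Fin p) (lamn : ℝ) (b : Others i → ℝ) : ℝ :=
  1 / (2 * (n : ℝ)) * ∑ r, (X r i - ∑ j : Others i, b j * X r j) ^ 2 +
    lamn * ∑ j : Others i, |b j|

/-- `b` is an optimal solution of the `i`-th nodewise Lasso. -/
def IsLassoSolution (X : Matrix (Fin n) (Fin p) ℝ) (i : Fin p) (lamn : ℝ) (b : Others i → ℝ) :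
    Prop :=
  ∀ b' : Others i → ℝ, lassoObjective X i lamn b ≤ lassoObjective X i lamn b'

/-! ### The sample size condition -/

/-- `f(s₀) = min(4 s₀ ρ_max(s₀) log(5ep/s₀), s₀ log p)`. -/
def fSize (S : Matrix (Fin p) (Fin p) ℝ) (s₀ : ℕ) : ℝ :=
  min (4 * s₀ * sparseMax (covSize S) s₀ * Real.log (5 * Real.exp 1 * p / s₀))
    (s₀ * Real.log p)

/-- The sample size condition, with the constants `c'` and `α`. -/
def SampleSize (S : Matrix (Fin p) (Fin p) ℝ) (n s s₀ : ℕ) (θ c' α : ℝ) : Prop :=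
  max (9 * c' * α ^ 4 / θ ^ 2 *
        max (36 * reConst (covSize S) s₀ 4 ^ 2 * fSize S s₀) (Real.log p))
      (80 * s * α ^ 4 / θ ^ 2 * Real.log (5 * Real.exp 1 * p / (s * θ))) < (n : ℝ)

/-! ### The events, as sets of `n × p` design matrices -/

/-- `F(θ)`: all columns have Euclidean norm close to `√n`. -/
def eventF (p n : ℕ) (θ : ℝ) : Set (Matrix (Fin n) (Fin p) ℝ) :=
  {X | ∀ j, 1 - θ ≤ l2On Finset.univ (fun r => X r j) / √(n : ℝ) ∧
    l2On Finset.univ (fun r => X r j) / √(n : ℝ) ≤ 1 + θ}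

/-- `R(θ)`: `RE(s₀, k₀, X)` holds with `0 < K(s₀, k₀, X) ≤ K(s₀, k₀, Σ₀) / (1 - θ)`. -/
def eventR (S : Matrix (Fin p) (Fin p) ℝ) (n s₀ : ℕ) (k₀ θ : ℝ) :
    Set (Matrix (Fin n) (Fin p) ℝ) :=
  {X | RE (designSize X) s₀ k₀ ∧ 0 < reConst (designSize X) s₀ k₀ ∧
    reConst (designSize X) s₀ k₀ ≤ reConst (covSize S) s₀ k₀ / (1 - θ)}

/-- `M(θ)`, with `k₀ = 4`: the `m`-sparse eigenvalues of the design and of `Σ₀` are comparable for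
all positive integers `m ≤ max(s, (k₀ + 1) s₀)`. -/
def eventM (S : Matrix (Fin p) (Fin p) ℝ) (n s s₀ : ℕ) (θ : ℝ) :
    Set (Matrix (Fin n) (Fin p) ℝ) :=
  {X | ∀ m : ℕ, 1 ≤ m → m ≤ max s ((4 + 1) * s₀) →
    0 < (1 - θ) * √(sparseMin (covSize S) m) ∧
    (1 - θ) * √(sparseMin (covSize S) m) ≤ √(sparseMin (designSize X) m) ∧
    √(sparseMin (designSize X) m) ≤ √(sparseMax (designSize X) m) ∧
    √(sparseMax (designSize X) m) ≤ (1 + θ) * √(sparseMax (covSize S) m)}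

/-- `𝒳 = R(θ) ∩ F(θ) ∩ M(θ)`. -/
def eventX (S : Matrix (Fin p) (Fin p) ℝ) (n s s₀ : ℕ) (θ : ℝ) :
    Set (Matrix (Fin n) (Fin p) ℝ) :=
  eventR S n s₀ 4 θ ∩ eventF p n θ ∩ eventM S n s s₀ θ

/-- `C_a`: all `Z_{jk} = (1/n) ⟨V_j / σ_{V_j}, X_k⟩`, `j ≠ k`, are smaller than
`√(1+a) √(2 log p / n)` in absolute value. -/
def eventC (S : Matrix (Fin p) (Fin p) ℝ) (n : ℕ) (a : ℝ) : Set (Matrix (Fin n) (Fin p) ℝ) :=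
  {X | ∀ j k, k ≠ j →
    |1 / (n : ℝ) * ∑ r, noise S X j r / √(noiseVar S j) * X r k| < √(1 + a) * lam p n}

/-! ### The constants `D₀` and `D₁`

Here `K = K(s₀, 4, Σ₀)`, and `k` is the essential sparsity of the regression at hand. -/

/-- `D = 3(1+θ)√ρ_max(s-k) / ((1-θ)√ρ_min(2k))
  + 2(1+θ)⁴ ρ_max(3k) ρ_max(s-k) / (d₀ (1-θ)² ρ_min(2k))`. -/
def constD (S : Matrix (Fin p) (Fin p) ℝ) (s k : ℕ) (θ d₀ : ℝ) : ℝ :=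
  3 * (1 + θ) * √(sparseMax (covSize S) (s - k)) / ((1 - θ) * √(sparseMin (covSize S) (2 * k))) +
  2 * (1 + θ) ^ 4 * sparseMax (covSize S) (3 * k) * sparseMax (covSize S) (s - k) /
    (d₀ * (1 - θ) ^ 2 * sparseMin (covSize S) (2 * k))

/-- `D₀ = max{D/d₀, 2√2(1+θ) K √ρ_max(s-k) / ((1-θ)d₀) + 3√2 K² / (1-θ)²}`. -/
def constD0 (S : Matrix (Fin p) (Fin p) ℝ) (s s₀ k : ℕ) (θ d₀ : ℝ) : ℝ :=
  max (constD S s k θ d₀ / d₀)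
    (2 * √2 * (1 + θ) *
        (reConst (covSize S) s₀ 4 * √(sparseMax (covSize S) (s - k)) / ((1 - θ) * d₀)) +
      3 * √2 * reConst (covSize S) s₀ 4 ^ 2 / (1 - θ) ^ 2)

/-- `D₁ = max{4(1+θ)² ρ_max(s-k) / d₀², ((1+θ)√ρ_max(s-k) / d₀ + 3K / (2(1-θ)))²}`. -/
def constD1 (S : Matrix (Fin p) (Fin p) ℝ) (s s₀ k : ℕ) (θ d₀ : ℝ) : ℝ :=
  max (4 * (1 + θ) ^ 2 * sparseMax (covSize S) (s - k) / d₀ ^ 2)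
    (((1 + θ) * √(sparseMax (covSize S) (s - k)) / d₀ +
      3 * reConst (covSize S) s₀ 4 / (2 * (1 - θ))) ^ 2)

end NodewiseLasso

end

open NodewiseLasso

namespace NodewiseLasso

/-! ### Norms on index sets. -/

section Core

variable {ι : Type*}

/-! On the events the argument is deterministic. Write the response over `√n` as `L β + w`, with `L`
the normalized design and `w` the normalized noise. Since `σ_V ≤ 1` and `d₀ ≥ 2√(1+a)`, `eventC`
bounds `|⟨w, L v⟩|` by `λ_n/2` times `‖v‖₁`. Comparing the minimizer with `β_{T₀}` instead of `β`
(`lasso_basic_inequality`) gives, for `x = ‖L h‖`, `x² + λ_n‖h_{T₀ᶜ}‖₁ ≤ 3λ_n‖h_{T₀}‖₁ + 2Ax`, where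
`A` bounds the bias `‖L β_{T₀ᶜ}‖`. The bias is small because `β_{T₀ᶜ}` has at most `s - k` nonzero
entries and Euclidean norm at most `λ√k`.

`lasso_cone_alternative` splits on `‖h_{T₀ᶜ}‖₁ ≤ 4‖h_{T₀}‖₁`. In this cone, the restricted
eigenvalue bounds the right-hand side by a multiple of `x`. Outside it, the left-hand side absorbs
the term `3λ_n‖h_{T₀}‖₁`, which leaves `x ≤ 2A` and `λ_n‖h_{T₀ᶜ}‖₁ ≤ 4A²`. The norm on `T₀₁` then
comes from sparse eigenvalues: the rest of `h` is cut into blocks of `k` entries in decreasing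
order, and their interaction with `h_{T₀₁}` is controlled by `abs_inner_restrictTo_le` and
`sqrt_mul_abs_functional_sdiff_le`. The two cases produce the two entries of the maxima in `D₀` and
`D₁`; `l2On_sub_le` passes from `h` to `b - β`. -/

theorem l2On_nonneg (J : Finset ι) (v : ι → ℝ) : 0 ≤ l2On J v := Real.sqrt_nonneg _

theorem l1On_nonneg (J : Finset ι) (v : ι → ℝ) : 0 ≤ l1On J v :=
  Finset.sum_nonneg fun _ _ => abs_nonneg _

theorem l2On_sq (J : Finset ι) (v : ι → ℝ) : l2On J v ^ 2 = ∑ j ∈ J, v j ^ 2 :=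
  Real.sq_sqrt (Finset.sum_nonneg fun _ _ => sq_nonneg _)

theorem l1On_le_sqrt_mul_l2On {J : Finset ι} {k : ℕ} (hJ : J.card ≤ k) (v : ι → ℝ) :
    l1On J v ≤ √(k : ℝ) * l2On J v := by
  refine abs_le_of_sq_le_sq' ?_ (mul_nonneg (Real.sqrt_nonneg _) (l2On_nonneg _ _)) |>.2
  rw [mul_pow, l2On_sq, Real.sq_sqrt (Nat.cast_nonneg k)]
  calc l1On J v ^ 2 ≤ J.card * ∑ j ∈ J, |v j| ^ 2 := sq_sum_le_card_mul_sum_sq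
    _ ≤ k * ∑ j ∈ J, v j ^ 2 := by
        simp only [sq_abs]
        gcongr

/-! ### Sets of largest entries. -/

variable [DecidableEq ι]

theorem exists_isLargestOn (A : Finset ι) (k : ℕ) (v : ι → ℝ) : ∃ T, IsLargestOn A k v T := by
  induction k with
  | zero => exact ⟨∅, by simp [IsLargestOn]⟩
  | succ k ih =>
    obtain ⟨T, hTA, hc, hT⟩ := ih
    by_cases hk : A.card ≤ k
    · refine ⟨T, hTA, ?_, hT⟩
      omega
    · have hne : (A \ T).Nonempty := by
        rw [← Finset.card_pos, Finset.card_sdiff_of_subset hTA]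
        omega
      obtain ⟨j, hj, hmax⟩ := Finset.exists_max_image (A \ T) (fun l => |v l|) hne
      rw [Finset.mem_sdiff] at hj
      refine ⟨insert j T, Finset.insert_subset hj.1 hTA, ?_, ?_⟩
      · rw [Finset.card_insert_of_notMem hj.2]
        omega
      · intro i hi l hl hlT
        rw [Finset.mem_insert, not_or] at hlT
        rcases Finset.mem_insert.1 hi with rfl | hi
        · exact hmax l (Finset.mem_sdiff.2 ⟨hl, hlT.2⟩)
        · exact hT i hi l hl hlT.2

/-- Exchange argument: `B \ T` has no more elements than `T \ B`, and every entry in the latter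
dominates every entry in the former. -/
theorem IsLargestOn.sum_le_sum {A T B : Finset ι} {k : ℕ} {v : ι → ℝ} (hT : IsLargestOn A k v T)
    (hBA : B ⊆ A) (hB : B.card ≤ k) {f : ι → ℝ} (hf : ∀ j, 0 ≤ f j)
    (hvf : ∀ l j, |v l| ≤ |v j| → f l ≤ f j) : ∑ j ∈ B, f j ≤ ∑ j ∈ T, f j := by
  obtain ⟨hTA, hc, hl⟩ := hT
  have hBc := Finset.card_le_card hBA
  have hcard : (B \ T).card ≤ (T \ B).card := by
    have h1 := Finset.card_sdiff_add_card_inter B T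
    have h2 := Finset.card_sdiff_add_card_inter T B
    rw [Finset.inter_comm] at h2
    omega
  have key : ∑ j ∈ B \ T, f j ≤ ∑ j ∈ T \ B, f j := by
    rcases (T \ B).eq_empty_or_nonempty with he | hne
    · have : B \ T = ∅ := by
        rw [← Finset.card_eq_zero]
        rw [he, Finset.card_empty] at hcard
        omega
      rw [he, this]
    · obtain ⟨m, hm, hmin⟩ := Finset.exists_min_image (T \ B) f hne
      calc ∑ j ∈ B \ T, f j ≤ (B \ T).card • f m := Finset.sum_le_card_nsmul _ _ _ fun l hlB => by
            rw [Finset.mem_sdiff] at hlB hm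
            exact hvf _ _ (hl m hm.1 l (hBA hlB.1) hlB.2)
        _ ≤ (T \ B).card • f m := nsmul_le_nsmul_left (hf m) hcard
        _ ≤ ∑ j ∈ T \ B, f j := Finset.card_nsmul_le_sum _ _ _ hmin
  have h1 := Finset.sum_inter_add_sum_sdiff B T f
  have h2 := Finset.sum_inter_add_sum_sdiff T B f
  rw [Finset.inter_comm] at h2
  linarith

theorem IsLargestOn.l1On_le {A T B : Finset ι} {k : ℕ} {v : ι → ℝ} (hT : IsLargestOn A k v T)
    (hBA : B ⊆ A) (hB : B.card ≤ k) : l1On B v ≤ l1On T v :=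
  hT.sum_le_sum hBA hB (fun _ => abs_nonneg _) fun _ _ h => h

theorem IsLargestOn.l2On_le {A T B : Finset ι} {k : ℕ} {v : ι → ℝ} (hT : IsLargestOn A k v T)
    (hBA : B ⊆ A) (hB : B.card ≤ k) : l2On B v ≤ l2On T v :=
  Real.sqrt_le_sqrt <|
    hT.sum_le_sum hBA hB (fun _ => sq_nonneg _) fun _ _ h => sq_le_sq.2 h

omit [DecidableEq ι] in
theorem IsLargestOn.card_le {A T : Finset ι} {k : ℕ} {v : ι → ℝ} (hT : IsLargestOn A k v T) :
    T.card ≤ k := hT.2.1 ▸ min_le_left _ _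

omit [DecidableEq ι] in
/-- Entries left out by a set of the `k` largest ones are at most the mean of those. -/
theorem IsLargestOn.mul_abs_le {A T : Finset ι} {k : ℕ} {v : ι → ℝ} (hT : IsLargestOn A k v T)
    {l : ι} (hl : l ∈ A) (hlT : l ∉ T) : k * |v l| ≤ l1On T v := by
  obtain ⟨hTA, hc, hle⟩ := hT
  have hlt : T.card < A.card :=
    Finset.card_lt_card ⟨hTA, fun h => hlT (h hl)⟩
  have hk : T.card = k := by omega
  have := Finset.card_nsmul_le_sum T (fun j => |v j|) |v l| fun j hj => hle j hj l hl hlT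
  rwa [nsmul_eq_mul, hk] at this

/-- A further block outside a set of the `k` largest entries has a small Euclidean norm. -/
theorem IsLargestOn.sqrt_mul_l2On_le {A T B : Finset ι} {k : ℕ} {v : ι → ℝ}
    (hT : IsLargestOn A k v T) (hB : B ⊆ A \ T) (hBk : B.card ≤ k) :
    √(k : ℝ) * l2On B v ≤ l1On T v := by
  refine abs_le_of_sq_le_sq' ?_ (l1On_nonneg _ _) |>.2
  rw [mul_pow, l2On_sq, Real.sq_sqrt (Nat.cast_nonneg k)]
  rcases Nat.eq_zero_or_pos k with rfl | hk
  · simp only [Nat.cast_zero, zero_mul]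
    positivity
  have hk' : (0 : ℝ) < k := Nat.cast_pos.2 hk
  have h1 : ∑ j ∈ B, v j ^ 2 ≤ B.card • (l1On T v / k) ^ 2 :=
    Finset.sum_le_card_nsmul _ _ _ fun j hj => by
      have hj' := Finset.mem_sdiff.1 (hB hj)
      rw [← sq_abs]
      gcongr
      rw [le_div_iff₀ hk', mul_comm]
      exact hT.mul_abs_le hj'.1 hj'.2
  have hBk' : (B.card : ℝ) ≤ k := Nat.cast_le.2 hBk
  calc k * ∑ j ∈ B, v j ^ 2 ≤ k * (k * (l1On T v / k) ^ 2) := by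
        rw [nsmul_eq_mul] at h1
        gcongr
        exact h1.trans (by gcongr)
    _ = l1On T v ^ 2 := by field_simp

/-- The Euclidean norm outside a set of the `k` largest entries, against the `ℓ₁` norm. -/
theorem IsLargestOn.mul_sq_l2On_sdiff_le {A T : Finset ι} {k : ℕ} {v : ι → ℝ}
    (hT : IsLargestOn A k v T) : k * l2On (A \ T) v ^ 2 ≤ l1On A v ^ 2 := by
  rw [l2On_sq, Finset.mul_sum]
  have hsub : l1On T v ≤ l1On A v :=
    Finset.sum_le_sum_of_subset_of_nonneg hT.1 fun _ _ _ => abs_nonneg _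
  have hsub' : l1On (A \ T) v ≤ l1On A v :=
    Finset.sum_le_sum_of_subset_of_nonneg Finset.sdiff_subset fun _ _ _ => abs_nonneg _
  calc ∑ j ∈ A \ T, k * v j ^ 2 ≤ ∑ j ∈ A \ T, l1On T v * |v j| :=
        Finset.sum_le_sum fun j hj => by
          rw [Finset.mem_sdiff] at hj
          rw [← sq_abs, sq, ← mul_assoc]
          exact mul_le_mul_of_nonneg_right (hT.mul_abs_le hj.1 hj.2) (abs_nonneg _)
    _ = l1On T v * l1On (A \ T) v := by rw [l1On, l1On, Finset.mul_sum]
    _ ≤ l1On A v ^ 2 := by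
        rw [sq]
        exact mul_le_mul hsub hsub' (l1On_nonneg _ _) (l1On_nonneg _ _)

/-! ### Decomposition into blocks of `k` entries. -/

theorem restrictTo_eq_add {A T : Finset ι} (h : T ⊆ A) (v : ι → ℝ) :
    restrictTo A v = restrictTo T v + restrictTo (A \ T) v := by
  ext j
  by_cases hj : j ∈ T
  · simp [restrictTo, hj, h hj]
  · simp [restrictTo, hj]

theorem l1On_eq_add {A T : Finset ι} (h : T ⊆ A) (v : ι → ℝ) :
    l1On A v = l1On T v + l1On (A \ T) v := by
  rw [l1On, ← Finset.sum_sdiff h, add_comm]; rfl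

/-- Block decomposition: a linear functional that is bounded by the Euclidean norm on all blocks of
size `k` is bounded, outside the `k` largest entries, by the `ℓ₁` norm over `√k`. -/
theorem sqrt_mul_abs_functional_sdiff_le {k : ℕ} (hk : 0 < k) (v : ι → ℝ) (F : (ι → ℝ) →ₗ[ℝ] ℝ)
    {C : ℝ} (hC : 0 ≤ C) {A T : Finset ι} (hT : IsLargestOn A k v T)
    (hF : ∀ B ⊆ A \ T, B.card ≤ k → |F (restrictTo B v)| ≤ C * l2On B v) :
    √(k : ℝ) * |F (restrictTo (A \ T) v)| ≤ C * l1On A v := by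
  induction hm : A.card using Nat.strong_induction_on generalizing A T with
  | _ m ih =>
    have hTA := l1On_eq_add hT.1 v
    rcases (A \ T).eq_empty_or_nonempty with he | hne
    · have : restrictTo (A \ T) v = 0 := by
        ext j
        simp [restrictTo, he]
      rw [this, map_zero, abs_zero, mul_zero]
      exact mul_nonneg hC (l1On_nonneg _ _)
    -- Peel off the next block `T'`. Its entries are at most the mean over `T`, so it costs
    -- `C‖v_T‖₁`; by induction the remainder costs `C‖v_{A \ T}‖₁`, and the two add up to `C‖v_A‖₁`.
    · obtain ⟨T', hT'⟩ := exists_isLargestOn (A \ T) k v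
      have hlt : (A \ T).card < m := by
        rw [← Finset.card_pos] at hne
        have h1 := hT.2.1
        have h2 := Finset.card_sdiff_of_subset hT.1
        omega
      have h1 := ih _ hlt hT'
        (fun B hB hBk => hF B (hB.trans Finset.sdiff_subset) hBk) rfl
      have h2 := hT.sqrt_mul_l2On_le hT'.1 hT'.card_le
      have h3 := hF T' hT'.1 hT'.card_le
      rw [restrictTo_eq_add hT'.1, map_add]
      calc √(k : ℝ) * |F (restrictTo T' v) + F (restrictTo ((A \ T) \ T') v)|
          ≤ √(k : ℝ) * (|F (restrictTo T' v)| + |F (restrictTo ((A \ T) \ T') v)|) := by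
            gcongr
            exact abs_add_le _ _
        _ ≤ √(k : ℝ) * (C * l2On T' v) + C * l1On (A \ T) v := by
            rw [mul_add]
            gcongr
        _ ≤ C * l1On A v := by
            rw [hTA]
            nlinarith

/-! ### The Lasso for a linear map into an inner product space. -/

variable [Fintype ι] {E : Type*} [NormedAddCommGroup E] [InnerProductSpace ℝ E]

omit [DecidableEq ι] [Fintype ι] in
-- Polarization with the negative square discarded. The weights `s = N`, `t = ±M` balance the two
-- terms and yield the factor `1/2` that Cauchy–Schwarz would miss.
theorem abs_inner_image_le {L : (ι → ℝ) →ₗ[ℝ] E} {R : ℝ} {u v : ι → ℝ} {M N : ℝ}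
    (hM : 0 ≤ M) (hN : 0 ≤ N)
    (hadd : ∀ s t : ℝ, ‖L (s • u + t • v)‖ ^ 2 ≤ R ^ 2 * (s ^ 2 * M ^ 2 + t ^ 2 * N ^ 2))
    : |inner ℝ (L u) (L v)| ≤ R ^ 2 / 2 * (M * N) := by
  have hp : ∀ s t : ℝ, 4 * (s * t) * inner ℝ (L u) (L v) =
      ‖L (s • u + t • v)‖ ^ 2 - ‖L (s • u + (-t) • v)‖ ^ 2 := by
    intro s t
    simp only [map_add, map_smul, norm_add_sq_real, inner_smul_left, inner_smul_right, norm_smul,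
      RCLike.conj_to_real, mul_pow, Real.norm_eq_abs, sq_abs]
    ring
  have hb : ∀ s t : ℝ, 4 * (s * t) * inner ℝ (L u) (L v) ≤
      R ^ 2 * (s ^ 2 * M ^ 2 + t ^ 2 * N ^ 2) := fun s t => by
    rw [hp]
    nlinarith [hadd s t, sq_nonneg ‖L (s • u + (-t) • v)‖]
  have hzero : M = 0 → L u = 0 := fun h0 => by
    have := hadd 1 0
    simp only [one_smul, zero_smul, add_zero, h0] at this
    have : ‖L u‖ ^ 2 ≤ 0 := by simpa using this
    exact norm_eq_zero.1 (pow_eq_zero_iff two_ne_zero |>.1 (le_antisymm this (sq_nonneg _)))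
  have hzero' : N = 0 → L v = 0 := fun h0 => by
    have := hadd 0 1
    simp only [one_smul, zero_smul, zero_add, h0] at this
    have : ‖L v‖ ^ 2 ≤ 0 := by simpa using this
    exact norm_eq_zero.1 (pow_eq_zero_iff two_ne_zero |>.1 (le_antisymm this (sq_nonneg _)))
  rcases hM.eq_or_lt with h0 | hM
  · simp [hzero h0.symm, ← h0]
  rcases hN.eq_or_lt with h0 | hN
  · simp [hzero' h0.symm, ← h0]
  have hMN := mul_pos hM hN
  rw [abs_le]
  constructor
  · have := hb N (-M)
    have : 0 ≤ (N * M) * (4 * inner ℝ (L u) (L v) + 2 * R ^ 2 * (M * N)) := by nlinarith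
    nlinarith [nonneg_of_mul_nonneg_right this (by positivity)]
  · have := hb N M
    have : 0 ≤ (N * M) * (2 * R ^ 2 * (M * N) - 4 * inner ℝ (L u) (L v)) := by nlinarith
    nlinarith [nonneg_of_mul_nonneg_right this (by positivity)]

omit [Fintype ι] in
theorem abs_inner_restrictTo_le {L : (ι → ℝ) →ₗ[ℝ] E} {R : ℝ} {U B : Finset ι}
    (hUB : Disjoint U B) (v : ι → ℝ)
    (hR : ∀ w, ‖L (restrictTo (U ∪ B) w)‖ ≤ R * l2On (U ∪ B) w) :
    |inner ℝ (L (restrictTo U v)) (L (restrictTo B v))| ≤ R ^ 2 / 2 * (l2On U v * l2On B v) := by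
  refine abs_inner_image_le (l2On_nonneg _ _) (l2On_nonneg _ _) fun s t => ?_
  set w : ι → ℝ := s • restrictTo U v + t • restrictTo B v with hw
  have hwU : ∀ j ∈ U, w j = s * v j := fun j hj => by
    simp [hw, restrictTo, hj, Finset.disjoint_left.1 hUB hj]
  have hwB : ∀ j ∈ B, w j = t * v j := fun j hj => by
    simp [hw, restrictTo, hj, Finset.disjoint_right.1 hUB hj]
  have h1 : restrictTo (U ∪ B) w = w := by
    ext j
    by_cases hU : j ∈ U <;> by_cases hB : j ∈ B <;> simp [hw, restrictTo, hU, hB]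
  have h2 : l2On (U ∪ B) w ^ 2 = s ^ 2 * l2On U v ^ 2 + t ^ 2 * l2On B v ^ 2 := by
    rw [l2On_sq, l2On_sq, l2On_sq, Finset.sum_union hUB, Finset.mul_sum, Finset.mul_sum]
    congr 1
    · exact Finset.sum_congr rfl fun j hj => by rw [hwU j hj, mul_pow]
    · exact Finset.sum_congr rfl fun j hj => by rw [hwB j hj, mul_pow]
  have h3 := hR w
  rw [h1] at h3
  rw [← h2, ← mul_pow]
  exact pow_le_pow_left₀ (norm_nonneg _) h3 2

/-- The basic inequality of the Lasso, relative to the approximation `β_{T₀}` of `β`. -/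
theorem lasso_basic_inequality {L : (ι → ℝ) →ₗ[ℝ] E} {w : E} {β b h : ι → ℝ} {T₀ : Finset ι}
    {lamn A : ℝ}
    (hnoise : ∀ v, |inner ℝ w (L v)| ≤ lamn / 2 * l1On Finset.univ v)
    (hopt : ‖L β + w - L b‖ ^ 2 / 2 + lamn * l1On Finset.univ b ≤
      ‖L β + w - L (restrictTo T₀ β)‖ ^ 2 / 2 + lamn * l1On Finset.univ (restrictTo T₀ β))
    (hlam : 0 ≤ lamn) (hA : ‖L (restrictTo T₀ᶜ β)‖ ≤ A) (hh : h = b - restrictTo T₀ β) :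
    ‖L h‖ ^ 2 + lamn * l1On T₀ᶜ h ≤ 3 * lamn * l1On T₀ h + 2 * A * ‖L h‖ := by
  have hb : b = restrictTo T₀ β + h := by rw [hh]; abel
  have hβ : β = restrictTo T₀ β + restrictTo T₀ᶜ β := by
    ext j
    by_cases hj : j ∈ T₀ <;> simp [restrictTo, hj]
  set g := restrictTo T₀ᶜ β with hg
  have hLβ : L β = L (restrictTo T₀ β) + L g := by rw [← map_add, ← hβ]
  have e1 : L β + w - L (restrictTo T₀ β) = L g + w := by
    rw [hLβ]; abel
  have e2 : L β + w - L b = (L g + w) - L h := by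
    rw [hLβ, hb, map_add]; abel
  rw [e1, e2, norm_sub_sq_real, inner_add_left] at hopt
  have hn := (abs_le.1 (hnoise h)).2
  have hcs : inner ℝ (L g) (L h) ≤ A * ‖L h‖ :=
    (real_inner_le_norm _ _).trans (mul_le_mul_of_nonneg_right hA (norm_nonneg _))
  have hsplit : ∀ v, l1On Finset.univ v = l1On T₀ v + l1On T₀ᶜ v := fun v =>
    (Finset.sum_add_sum_compl T₀ fun j => |v j|).symm
  -- Outside `T₀` the comparison vector vanishes, so `b` and `h` agree there; on `T₀` the triangle
  -- inequality suffices.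
  have hl : l1On Finset.univ (restrictTo T₀ β) - l1On Finset.univ b ≤ l1On T₀ h - l1On T₀ᶜ h := by
    rw [hsplit, hsplit b]
    have h1 : l1On T₀ᶜ (restrictTo T₀ β) = 0 := Finset.sum_eq_zero fun j hj => by
      simp [restrictTo, Finset.mem_compl.1 hj]
    have h2 : l1On T₀ᶜ b = l1On T₀ᶜ h := Finset.sum_congr rfl fun j hj => by
      simp [hb, restrictTo, Finset.mem_compl.1 hj]
    have h3 : l1On T₀ (restrictTo T₀ β) ≤ l1On T₀ b + l1On T₀ h := by
      rw [l1On, l1On, l1On, ← Finset.sum_add_distrib]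
      refine Finset.sum_le_sum fun j _ => ?_
      have : restrictTo T₀ β j = b j - h j := by rw [hb]; simp
      rw [this]
      exact abs_sub _ _
    linarith
  have hl' := mul_le_mul_of_nonneg_left hl hlam
  rw [hsplit h] at hn
  nlinarith

/-- Deterministic oracle inequalities: either `h` lies in the cone where restricted eigenvalues
apply, or its `ℓ₁` norm is controlled by the approximation error. -/
theorem lasso_cone_alternative {L : (ι → ℝ) →ₗ[ℝ] E} {h : ι → ℝ} {T₀ T₁ : Finset ι}
    {lamn A K R m : ℝ} {k : ℕ} (hk : 0 < k)
    (hbasic : ‖L h‖ ^ 2 + lamn * l1On T₀ᶜ h ≤ 3 * lamn * l1On T₀ h + 2 * A * ‖L h‖)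
    (hlam : 0 < lamn) (hA : 0 ≤ A) (hK : 0 ≤ K) (hm : 0 < m)
    (hT₀ : T₀.card ≤ k) (hT₁ : IsLargestOn T₀ᶜ k h T₁)
    (hRE : ∀ J : Finset ι, J.card ≤ k → ∀ v, l1On Jᶜ v ≤ 4 * l1On J v → l2On J v ≤ K * ‖L v‖)
    (hlow : ∀ B : Finset ι, B.card ≤ 2 * k → ∀ v, m * l2On B v ≤ ‖L (restrictTo B v)‖)
    (hupp : ∀ B : Finset ι, B.card ≤ 3 * k → ∀ v, ‖L (restrictTo B v)‖ ≤ R * l2On B v) :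
    (l2On (T₀ ∪ T₁) h ≤ √2 * (K * (3 * lamn * √k * K + 2 * A)) ∧
      lamn * l1On T₀ᶜ h ≤ ((3 * lamn * √k * K + 2 * A) / 2) ^ 2) ∨
    (l2On (T₀ ∪ T₁) h ≤ 2 * A / m + 2 * R ^ 2 * A ^ 2 / (m ^ 2 * (lamn * √k)) ∧
      lamn * l1On T₀ᶜ h ≤ 4 * A ^ 2) := by
  have hdisj : Disjoint T₀ T₁ := Finset.disjoint_left.2 fun j hj hj' =>
    Finset.mem_compl.1 (hT₁.1 hj') hj
  have hx := norm_nonneg (L h)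
  set x := ‖L h‖ with hxdef
  have hsk : 0 < √(k : ℝ) := Real.sqrt_pos.2 (Nat.cast_pos.2 hk)
  by_cases hcone : l1On T₀ᶜ h ≤ 4 * l1On T₀ h
  · left
    -- `T₀` holds the largest entries of `β`, not of `h`. The `k` largest entries of `h` also
    -- satisfy the cone condition, and their norm dominates those on both `T₀` and `T₁`; hence the
    -- factor `√2`.
    obtain ⟨J, hJ⟩ := exists_isLargestOn Finset.univ k h
    have hJ1 := hJ.l1On_le (Finset.subset_univ T₀) hT₀
    have hJc : l1On Jᶜ h ≤ 4 * l1On J h := by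
      have e1 : l1On J h + l1On Jᶜ h = _ := Finset.sum_add_sum_compl J fun j => |h j|
      have e2 : l1On T₀ h + l1On T₀ᶜ h = _ := Finset.sum_add_sum_compl T₀ fun j => |h j|
      linarith
    have hJ2 := hRE J hJ.card_le h hJc
    have h0 := hRE T₀ hT₀ h hcone
    have h01 : l1On T₀ h ≤ √k * (K * x) := (l1On_le_sqrt_mul_l2On hT₀ h).trans (by gcongr)
    have hmain : x ^ 2 + lamn * l1On T₀ᶜ h ≤ (3 * lamn * √k * K + 2 * A) * x := by
      have := mul_le_mul_of_nonneg_left h01 (by positivity : 0 ≤ 3 * lamn)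
      nlinarith
    have hl1 := mul_nonneg hlam.le (l1On_nonneg T₀ᶜ h)
    constructor
    · have hxle : x ≤ 3 * lamn * √k * K + 2 * A := by
        rcases hx.eq_or_lt with h0 | h0
        · rw [← h0]; positivity
        · nlinarith
      have hJ' : l2On J h ≤ K * (3 * lamn * √k * K + 2 * A) := hJ2.trans (by gcongr)
      have ha := hJ.l2On_le (Finset.subset_univ T₀) hT₀
      have hb := hJ.l2On_le (Finset.subset_univ T₁) hT₁.card_le
      refine abs_le_of_sq_le_sq' ?_ (by positivity) |>.2
      rw [mul_pow, Real.sq_sqrt zero_le_two, l2On_sq, Finset.sum_union hdisj, ← l2On_sq, ← l2On_sq]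
      have := pow_le_pow_left₀ (l2On_nonneg _ _) (ha.trans hJ') 2
      have := pow_le_pow_left₀ (l2On_nonneg _ _) (hb.trans hJ') 2
      linarith
    -- Completing the square: `Bx - x² ≤ (B/2)²`.
    · nlinarith [sq_nonneg (x - (3 * lamn * √k * K + 2 * A) / 2)]
  · right
    rw [not_le] at hcone
    -- Off the cone, `3‖h_{T₀}‖₁ < (3/4)‖h_{T₀ᶜ}‖₁`, so a quarter of the left-hand `ℓ₁` term
    -- survives.
    have hmain : x ^ 2 + lamn * l1On T₀ᶜ h / 4 ≤ 2 * A * x := by nlinarith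
    have hl1 := mul_nonneg hlam.le (l1On_nonneg T₀ᶜ h)
    have hl : lamn * l1On T₀ᶜ h ≤ 4 * A ^ 2 := by nlinarith [sq_nonneg (x - A)]
    refine ⟨?_, hl⟩
    have hxle : x ≤ 2 * A := by
      rcases hx.eq_or_lt with h0 | h0
      · rw [← h0]; positivity
      · nlinarith
    set U := T₀ ∪ T₁ with hU
    have hUc : U.card ≤ 2 * k := by
      have := hU ▸ Finset.card_union_le T₀ T₁
      have := hT₁.card_le
      omega
    have hcompl : T₀ᶜ \ T₁ = Uᶜ := by ext j; simp [hU]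
    set W := l2On U h with hW
    have hW0 : 0 ≤ W := l2On_nonneg _ _
    set z := ‖L (restrictTo U h)‖ with hz
    have hz0 : 0 ≤ z := norm_nonneg _
    have hlowU : m * W ≤ z := hlow U hUc h
    -- `U` together with one block has at most `3k` indices, which is where the `3k`-sparse bound
    -- `R` enters.
    have hblock : √(k : ℝ) * |inner ℝ (L (restrictTo U h)) (L (restrictTo (T₀ᶜ \ T₁) h))| ≤
        R ^ 2 / 2 * W * l1On T₀ᶜ h := by
      refine sqrt_mul_abs_functional_sdiff_le hk h
        ((innerₛₗ ℝ (L (restrictTo U h))).comp L) (by positivity) hT₁ fun B hB hBk => ?_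
      rw [mul_assoc]
      rw [hcompl] at hB
      refine abs_inner_restrictTo_le ?_ h fun w => hupp _ ?_ w
      · exact Finset.disjoint_left.2 fun j hj hj' => Finset.mem_compl.1 (hB hj') hj
      · have := Finset.card_union_le U B
        omega
    have hdec : h = restrictTo U h + restrictTo (T₀ᶜ \ T₁) h := by
      rw [hcompl]
      ext j
      by_cases hj : j ∈ U <;> simp [restrictTo, hj]
    have hzz : z ^ 2 ≤ z * x + |inner ℝ (L (restrictTo U h)) (L (restrictTo (T₀ᶜ \ T₁) h))| := by
      have h1 : inner ℝ (L (restrictTo U h)) (L h) =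
          z ^ 2 + inner ℝ (L (restrictTo U h)) (L (restrictTo (T₀ᶜ \ T₁) h)) := by
        conv_lhs => rw [hdec]
        rw [map_add, inner_add_right, ← hdec, real_inner_self_eq_norm_sq]
      have h2 := real_inner_le_norm (L (restrictTo U h)) (L h)
      have h3 := neg_abs_le (inner ℝ (L (restrictTo U h)) (L (restrictTo (T₀ᶜ \ T₁) h)))
      linarith
    set I := |inner ℝ (L (restrictTo U h)) (L (restrictTo (T₀ᶜ \ T₁) h))|
    have hI : I ≤ 2 * R ^ 2 * A ^ 2 / (lamn * √k) * W := by
      rw [div_mul_eq_mul_div, le_div_iff₀ (by positivity)]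
      have h1 := mul_le_mul_of_nonneg_left hblock hlam.le
      have h2 := mul_le_mul_of_nonneg_left hl (by positivity : 0 ≤ R ^ 2 / 2 * W)
      nlinarith
    set G := 2 * R ^ 2 * A ^ 2 / (lamn * √k) with hG
    have hG0 : 0 ≤ G := by positivity
    have hgoal : 2 * A / m + 2 * R ^ 2 * A ^ 2 / (m ^ 2 * (lamn * √k)) = (2 * A * m + G) / m ^ 2 := by
      rw [hG]; field_simp
    rw [hgoal, le_div_iff₀ (by positivity)]
    rcases hW0.eq_or_lt with h0 | hWpos
    · rw [← h0, zero_mul]; positivity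
    have hzpos : 0 < z := (mul_pos hm hWpos).trans_le hlowU
    -- From `z² ≤ zx + GW` with `x ≤ 2A` and `mW ≤ z`. Cancelling `z` needs `W > 0`; a final use of
    -- `mW ≤ z` bounds `W`.
    have h1 : z * (m * z) ≤ z * (2 * A * m + G) := by
      have h2 : m * z ^ 2 ≤ m * (z * (2 * A)) + G * z := by
        have := mul_le_mul_of_nonneg_left hxle hz0
        have := mul_le_mul_of_nonneg_left hlowU hG0
        nlinarith
      nlinarith
    have h2 := le_of_mul_le_mul_left h1 hzpos
    nlinarith

end Core

/-! ### Essential sparsity of a vector -/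

section Essential

variable {ι : Type*} [Fintype ι] [DecidableEq ι]

/-- If some square outside `T` exceeded `t`, so would all squares on `T`, and these `k + 1` entries
would already contribute `(k + 1)t` to the truncated sum. Hence no truncation occurs outside `T`. -/
theorem IsLargestOn.sum_sq_compl_le {v : ι → ℝ} {T : Finset ι} {k : ℕ} {t : ℝ} (ht : 0 < t)
    (hT : IsLargestOn Finset.univ k v T) (hv : ∑ j, min (v j ^ 2) t ≤ k * t) :
    ∑ j ∈ Tᶜ, v j ^ 2 ≤ k * t := by
  by_cases hall : ∀ j ∈ Tᶜ, v j ^ 2 ≤ t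
  · calc ∑ j ∈ Tᶜ, v j ^ 2 = ∑ j ∈ Tᶜ, min (v j ^ 2) t :=
          Finset.sum_congr rfl fun j hj => (min_eq_left (hall j hj)).symm
      _ ≤ ∑ j, min (v j ^ 2) t :=
          Finset.sum_le_sum_of_subset_of_nonneg (Finset.subset_univ _) fun j _ _ =>
            le_min (sq_nonneg _) ht.le
      _ ≤ k * t := hv
  · push Not at hall
    obtain ⟨l, hl, hlt⟩ := hall
    have hlT := Finset.mem_compl.1 hl
    have hk : T.card = k := by
      have h1 := hT.2.1
      have h2 := Finset.card_lt_univ_of_notMem hlT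
      rw [← Finset.card_univ] at h2
      omega
    exfalso
    have h1 : ∑ j ∈ insert l T, min (v j ^ 2) t ≤ ∑ j, min (v j ^ 2) t :=
      Finset.sum_le_sum_of_subset_of_nonneg (Finset.subset_univ _) fun j _ _ =>
        le_min (sq_nonneg _) ht.le
    have h2 : ∑ j ∈ insert l T, min (v j ^ 2) t = ∑ j ∈ insert l T, t :=
      Finset.sum_congr rfl fun j hj => min_eq_right <| by
        rcases Finset.mem_insert.1 hj with rfl | hj
        · exact hlt.le
        · exact hlt.le.trans (sq_le_sq.2 (hT.2.2 j hj l (Finset.mem_univ _) hlT))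
    rw [Finset.sum_const, Finset.card_insert_of_notMem hlT, hk, nsmul_eq_mul] at h2
    push_cast at h2
    nlinarith

/-- A nonzero entry left out of `T` forces every entry on `T` to be nonzero, so `T` removes `k`
elements of the support. -/
theorem IsLargestOn.card_support_sdiff_le {v : ι → ℝ} {T : Finset ι} {k : ℕ}
    (hT : IsLargestOn Finset.univ k v T)
    (hk : k ≤ (Finset.univ.filter fun j => v j ≠ 0).card) :
    ((Finset.univ.filter fun j => v j ≠ 0) \ T).card ≤
      (Finset.univ.filter fun j => v j ≠ 0).card - k := by
  rcases ((Finset.univ.filter fun j => v j ≠ 0) \ T).eq_empty_or_nonempty with he | ⟨l, hl⟩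
  · rw [he, Finset.card_empty]
    exact Nat.zero_le _
  · rw [Finset.mem_sdiff, Finset.mem_filter] at hl
    have hsub : T ⊆ Finset.univ.filter fun j => v j ≠ 0 := fun j hj =>
      Finset.mem_filter.2 ⟨Finset.mem_univ _, abs_pos.1 <|
        (abs_pos.2 hl.1.2).trans_le (hT.2.2 j hj l (Finset.mem_univ _) hl.2)⟩
    have h1 := Finset.card_le_card (Finset.subset_univ (Finset.univ.filter fun j => v j ≠ 0))
    have h2 := hT.2.1
    rw [Finset.card_sdiff_of_subset hsub]
    omega

omit [DecidableEq ι] in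
theorem sum_min_sq_le_card_support_mul (v : ι → ℝ) {t : ℝ} (ht : 0 ≤ t) :
    ∑ j, min (v j ^ 2) t ≤ (Finset.univ.filter fun j => v j ≠ 0).card * t := by
  rw [← nsmul_eq_mul, ← Finset.sum_const, Finset.sum_filter]
  refine Finset.sum_le_sum fun j _ => ?_
  by_cases hj : v j = 0
  · simp [hj, ht]
  · simp [hj]

end Essential

variable {p n : ℕ}

/-! ### Restricted and sparse eigenvalues as inequalities -/

theorem designSize_nonneg (X : Matrix (Fin n) (Fin p) ℝ) (v : Fin p → ℝ) : 0 ≤ designSize X v :=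
  div_nonneg (l2On_nonneg _ _) (Real.sqrt_nonneg _)

theorem l2On_le_reConst_mul {q : (Fin p → ℝ) → ℝ} (hq : ∀ v, 0 ≤ q v) {s₀ : ℕ} {k₀ : ℝ}
    (hRE : 0 < sInf (reRatios q s₀ k₀)) {J : Finset (Fin p)} (hJ : J.card ≤ s₀) {v : Fin p → ℝ}
    (hv : l1On Jᶜ v ≤ k₀ * l1On J v) : l2On J v ≤ reConst q s₀ k₀ * q v := by
  rcases (l2On_nonneg J v).eq_or_lt with h0 | hpos
  · rw [← h0]
    exact mul_nonneg (inv_nonneg.2 hRE.le) (hq v)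
  · have hv0 : v ≠ 0 := by
      rintro rfl
      simp [l2On] at hpos
    have hbdd : BddBelow (reRatios q s₀ k₀) := ⟨0, by
      rintro _ ⟨J, -, v, -, -, rfl⟩
      exact div_nonneg (hq v) (l2On_nonneg _ _)⟩
    have h := csInf_le hbdd ⟨J, hJ, v, hv0, hv, rfl⟩
    rw [le_div_iff₀ hpos] at h
    rw [reConst, inv_mul_eq_div, le_div_iff₀ hRE]
    linarith

theorem sparseMax_nonneg (q : (Fin p → ℝ) → ℝ) (m : ℕ) : 0 ≤ sparseMax q m :=
  Real.sSup_nonneg fun _ ⟨_, _, _, hr⟩ => hr ▸ by positivity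

theorem sparseMin_nonneg (q : (Fin p → ℝ) → ℝ) (m : ℕ) : 0 ≤ sparseMin q m :=
  Real.sInf_nonneg fun _ ⟨_, _, _, hr⟩ => hr ▸ by positivity

theorem l2On_univ_pos {ι : Type*} [Fintype ι] {v : ι → ℝ} (hv : v ≠ 0) :
    0 < l2On Finset.univ v := by
  obtain ⟨j, hj⟩ := Function.ne_iff.1 hv
  exact Real.sqrt_pos.2 <| Finset.sum_pos' (fun _ _ => sq_nonneg _)
    ⟨j, Finset.mem_univ _, sq_pos_of_ne_zero hj⟩

/-- Cauchy–Schwarz on each row. Without boundedness `sSup` would take the default value `0` and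
bound nothing. -/
theorem bddAbove_sparseRatios_designSize (X : Matrix (Fin n) (Fin p) ℝ) (m : ℕ) :
    BddAbove (sparseRatios (designSize X) m) := by
  refine ⟨(∑ r, ∑ j, X r j ^ 2) / n, ?_⟩
  rintro _ ⟨v, hv, -, rfl⟩
  rw [div_le_iff₀ (pow_pos (l2On_univ_pos hv) 2), designSize, div_pow,
    Real.sq_sqrt (Nat.cast_nonneg n), div_mul_eq_mul_div, l2On_sq, l2On_sq, Finset.sum_mul]
  exact div_le_div_of_nonneg_right
    (Finset.sum_le_sum fun r _ =>
      Finset.sum_mul_sq_le_sq_mul_sq Finset.univ (X r) v) (Nat.cast_nonneg n)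

theorem designSize_le_sqrt_sparseMax_mul (X : Matrix (Fin n) (Fin p) ℝ) {m : ℕ} {v : Fin p → ℝ}
    (hv : (Finset.univ.filter fun j => v j ≠ 0).card ≤ m) :
    designSize X v ≤ √(sparseMax (designSize X) m) * l2On Finset.univ v := by
  rcases eq_or_ne v 0 with rfl | hv0
  · simp [designSize, l2On]
  · have h := le_csSup (bddAbove_sparseRatios_designSize X m) ⟨v, hv0, hv, rfl⟩
    rw [← div_pow] at h
    rw [← div_le_iff₀ (l2On_univ_pos hv0)]
    exact Real.le_sqrt_of_sq_le h

theorem sqrt_sparseMin_mul_le_designSize (X : Matrix (Fin n) (Fin p) ℝ) {m : ℕ} {v : Fin p → ℝ}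
    (hv : (Finset.univ.filter fun j => v j ≠ 0).card ≤ m) :
    √(sparseMin (designSize X) m) * l2On Finset.univ v ≤ designSize X v := by
  rcases eq_or_ne v 0 with rfl | hv0
  · simp [designSize, l2On]
  · have hbdd : BddBelow (sparseRatios (designSize X) m) := ⟨0, by
      rintro _ ⟨v, -, -, rfl⟩
      positivity⟩
    have h := csInf_le hbdd ⟨v, hv0, hv, rfl⟩
    rw [← div_pow] at h
    rw [← le_div_iff₀ (l2On_univ_pos hv0)]
    exact (Real.sqrt_le_left (div_nonneg (designSize_nonneg X v) (l2On_nonneg _ _))).2 h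

/-! ### The regression of one column on the others -/

/-- The normalized design `b ↦ ∑_{j ≠ i} b_j X_j / √n` of the `i`-th regression. -/
noncomputable def designMap (X : Matrix (Fin n) (Fin p) ℝ) (i : Fin p) :
    (Others i → ℝ) →ₗ[ℝ] EuclideanSpace ℝ (Fin n) where
  toFun b := WithLp.toLp 2 fun r => (∑ j : Others i, b j * X r j) / √(n : ℝ)
  map_add' b b' := by
    ext r
    simp [add_mul, Finset.sum_add_distrib, add_div]
  map_smul' c b := by
    ext r
    simp [mul_assoc, ← Finset.mul_sum, mul_div_assoc]

theorem designMap_apply (X : Matrix (Fin n) (Fin p) ℝ) (i : Fin p) (b : Others i → ℝ) (r : Fin n) :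
    designMap X i b r = (∑ j : Others i, b j * X r j) / √(n : ℝ) := rfl

/-- The noise vector of the `i`-th regression over `√n`. -/
noncomputable def scaledNoise (S : Matrix (Fin p) (Fin p) ℝ) (X : Matrix (Fin n) (Fin p) ℝ) (i : Fin p) :
    EuclideanSpace ℝ (Fin n) := WithLp.toLp 2 fun r => noise S X i r / √(n : ℝ)

/-- A vector of coefficients of the `i`-th regression, as a vector in `ℝᵖ` that vanishes at `i`. -/
noncomputable def extendZero (i : Fin p) (v : Others i → ℝ) : Fin p → ℝ := Function.extend Subtype.val v 0

theorem extendZero_coe (i : Fin p) (v : Others i → ℝ) (j : Others i) : extendZero i v j = v j :=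
  Subtype.val_injective.extend_apply _ _ _

theorem extendZero_self (i : Fin p) (v : Others i → ℝ) : extendZero i v i = 0 :=
  Function.extend_apply' _ _ _ fun ⟨j, hj⟩ => j.2 hj

theorem l1On_univ_extendZero (i : Fin p) (v : Others i → ℝ) :
    l1On Finset.univ (extendZero i v) = l1On Finset.univ v := by
  rw [l1On, Fintype.sum_eq_add_sum_subtype_ne _ i, extendZero_self, abs_zero, zero_add]
  simp only [extendZero_coe]
  rfl

theorem l2On_univ_extendZero (i : Fin p) (v : Others i → ℝ) :
    l2On Finset.univ (extendZero i v) = l2On Finset.univ v := by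
  rw [l2On, Fintype.sum_eq_add_sum_subtype_ne _ i, extendZero_self]
  simp only [extendZero_coe]
  simp [l2On]

theorem l1On_map_extendZero {i : Fin p} (J : Finset (Others i)) (v : Others i → ℝ) :
    l1On (J.map (Function.Embedding.subtype _)) (extendZero i v) = l1On J v := by
  simp [l1On, Finset.sum_map, extendZero_coe]

theorem l2On_map_extendZero {i : Fin p} (J : Finset (Others i)) (v : Others i → ℝ) :
    l2On (J.map (Function.Embedding.subtype _)) (extendZero i v) = l2On J v := by
  simp [l2On, Finset.sum_map, extendZero_coe]

/-- The complement in `Fin p` gains the index `i`, where the extension vanishes, so cone conditions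
transfer unchanged. -/
theorem l1On_compl_map_extendZero {i : Fin p} (J : Finset (Others i)) (v : Others i → ℝ) :
    l1On (J.map (Function.Embedding.subtype _))ᶜ (extendZero i v) = l1On Jᶜ v := by
  have h1 : l1On J v + l1On Jᶜ v = l1On Finset.univ v :=
    Finset.sum_add_sum_compl J fun j => |v j|
  have h2 : l1On (J.map (Function.Embedding.subtype _)) (extendZero i v) +
      l1On (J.map (Function.Embedding.subtype _))ᶜ (extendZero i v) =
        l1On Finset.univ (extendZero i v) :=
    Finset.sum_add_sum_compl _ fun j => |extendZero i v j|
  rw [l1On_map_extendZero, l1On_univ_extendZero] at h2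
  linarith

theorem card_support_extendZero (i : Fin p) (v : Others i → ℝ) :
    (Finset.univ.filter fun j => extendZero i v j ≠ 0).card =
      (Finset.univ.filter fun j => v j ≠ 0).card := by
  rw [← Finset.card_map (Function.Embedding.subtype _)]
  congr 1
  ext j
  by_cases hj : j = i
  · subst hj
    simp [extendZero_self]
  · have := extendZero_coe i v ⟨j, hj⟩
    simp only at this
    simp [this, hj]

theorem norm_designMap (X : Matrix (Fin n) (Fin p) ℝ) (i : Fin p) (v : Others i → ℝ) :
    ‖designMap X i v‖ = designSize X (extendZero i v) := by
  have h : ∀ r, X.mulVec (extendZero i v) r = ∑ j : Others i, v j * X r j := fun r => by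
    rw [Matrix.mulVec, dotProduct, Fintype.sum_eq_add_sum_subtype_ne _ i, extendZero_self, mul_zero,
      zero_add]
    exact Finset.sum_congr rfl fun j _ => by rw [extendZero_coe, mul_comm]
  have h' : ∀ r, ‖designMap X i v r‖ ^ 2 = X.mulVec (extendZero i v) r ^ 2 / n := fun r => by
    rw [designMap_apply, h, Real.norm_eq_abs, sq_abs, div_pow, Real.sq_sqrt (Nat.cast_nonneg n)]
  rw [EuclideanSpace.norm_eq, designSize, l2On, ← Real.sqrt_div' _ (Nat.cast_nonneg n),
    Finset.sum_div]
  simp only [h']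

theorem l2On_univ_restrictTo {ι : Type*} [Fintype ι] [DecidableEq ι] (B : Finset ι) (v : ι → ℝ) :
    l2On Finset.univ (restrictTo B v) = l2On B v := by
  simp [l2On, restrictTo, Finset.sum_ite_mem, ite_pow]

theorem card_support_restrictTo_le {ι : Type*} [Fintype ι] [DecidableEq ι] (B : Finset ι)
    (v : ι → ℝ) : (Finset.univ.filter fun j => restrictTo B v j ≠ 0).card ≤ B.card :=
  Finset.card_le_card fun j hj => by
    by_contra h
    simp [restrictTo, h] at hj

/-- Substitutes `X_i = ∑ βⁱ_j X_j + V_i`; the scaling by `√n` turns `1/(2n)` into `1/2`. -/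
theorem lassoObjective_eq (S : Matrix (Fin p) (Fin p) ℝ) (X : Matrix (Fin n) (Fin p) ℝ) (i : Fin p)
    (lamn : ℝ) (b : Others i → ℝ) :
    lassoObjective X i lamn b =
      ‖designMap X i (coef S i) + scaledNoise S X i - designMap X i b‖ ^ 2 / 2 +
        lamn * l1On Finset.univ b := by
  rw [lassoObjective, EuclideanSpace.norm_sq_eq, l1On]
  congr 1
  rw [Finset.mul_sum, Finset.sum_div]
  refine Finset.sum_congr rfl fun r _ => ?_
  have : (designMap X i (coef S i) + scaledNoise S X i - designMap X i b) r =
      (X r i - ∑ j : Others i, b j * X r j) / √(n : ℝ) := by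
    simp only [PiLp.sub_apply, PiLp.add_apply, designMap_apply, scaledNoise, noise]
    ring
  rw [this, Real.norm_eq_abs, sq_abs, div_pow, Real.sq_sqrt (Nat.cast_nonneg n)]
  ring

theorem inner_scaledNoise_designMap (S : Matrix (Fin p) (Fin p) ℝ) (X : Matrix (Fin n) (Fin p) ℝ)
    (i : Fin p) (v : Others i → ℝ) :
    inner ℝ (scaledNoise S X i) (designMap X i v) =
      ∑ j : Others i, v j * (1 / (n : ℝ) * ∑ r, noise S X i r * X r j) := by
  have h : ∀ r, inner ℝ (scaledNoise S X i r) (designMap X i v r) =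
      ∑ j : Others i, v j * (1 / (n : ℝ) * (noise S X i r * X r j)) := fun r => by
    have hn : √(n : ℝ) * √(n : ℝ) = n := Real.mul_self_sqrt (Nat.cast_nonneg n)
    have hn' : (1 / (n : ℝ)) = (√(n : ℝ))⁻¹ * (√(n : ℝ))⁻¹ := by rw [← mul_inv, hn, one_div]
    rw [designMap_apply, hn']
    simp only [scaledNoise, RCLike.inner_apply, RCLike.conj_to_real, Finset.sum_div, Finset.sum_mul]
    exact Finset.sum_congr rfl fun j _ => by ring
  rw [PiLp.inner_apply]
  simp only [h]
  rw [Finset.sum_comm]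
  simp only [Finset.mul_sum]

/-! ### The Gaussian graphical model -/

theorem inv_diag_pos {S : Matrix (Fin p) (Fin p) ℝ} (hS : S.PosDef) (i : Fin p) : 0 < S⁻¹ i i :=
  hS.inv.diag_pos

theorem noiseVar_pos {S : Matrix (Fin p) (Fin p) ℝ} (hS : S.PosDef) (i : Fin p) :
    0 < noiseVar S i := one_div_pos.2 (inv_diag_pos hS i)

/-- The residual variance is at most the variance. -/
theorem noiseVar_le_diag {S : Matrix (Fin p) (Fin p) ℝ} (hS : S.PosDef) (i : Fin p) :
    noiseVar S i ≤ S i i := by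
  have hpos := inv_diag_pos hS i
  have hu : S * S⁻¹ = 1 := Matrix.mul_nonsing_inv _ ((Matrix.isUnit_iff_isUnit_det _).1 hS.isUnit)
  set t := noiseVar S i with ht
  set e : Fin p → ℝ := Pi.single i 1 with he
  set w : Fin p → ℝ := S⁻¹.mulVec e with hw
  have hSw : S.mulVec w = e := by rw [hw, Matrix.mulVec_mulVec, hu, Matrix.one_mulVec]
  have hwi : w i = S⁻¹ i i := by simp [hw, he]
  -- With `w = Θ₀ e` and `t = 1/θ_{ii}`, this quadratic form equals `S i i - 2t + t²θ_{ii} = S i i -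
  -- t`.
  have h := hS.posSemidef.dotProduct_mulVec_nonneg (e - t • w)
  have hsym : w ⬝ᵥ S.mulVec e = 1 := by
    have hT : S.transpose = S := by simpa using hS.isHermitian.eq
    rw [Matrix.dotProduct_mulVec, ← Matrix.mulVec_transpose, hT, hSw]
    simp [he]
  have h1 : e ⬝ᵥ S.mulVec e = S i i := by simp [he]
  have h2 : e ⬝ᵥ e = 1 := by simp [he]
  have h3 : w ⬝ᵥ e = S⁻¹ i i := by rw [← hwi]; simp [he]
  have h4 : t * S⁻¹ i i = 1 := by rw [ht, noiseVar]; field_simp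
  simp only [star_trivial, Matrix.mulVec_sub, Matrix.mulVec_smul, hSw, sub_dotProduct,
    dotProduct_sub, smul_dotProduct, dotProduct_smul, h1, h2, h3, hsym, smul_eq_mul, mul_one] at h
  nlinarith

theorem nodeDegree_eq {S : Matrix (Fin p) (Fin p) ℝ} (hS : S.PosDef) (i : Fin p) :
    nodeDegree S i = (Finset.univ.filter fun j => coef S i j ≠ 0).card := by
  rw [nodeDegree, ← Finset.card_map (Function.Embedding.subtype _)]
  congr 1
  ext j
  simp [coef, (inv_diag_pos hS i).ne', and_comm]

theorem essSparsity_le_nodeDegree {S : Matrix (Fin p) (Fin p) ℝ} (hS : S.PosDef) (n : ℕ)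
    (i : Fin p) : essSparsity S n i ≤ nodeDegree S i := by
  refine Nat.sInf_le ?_
  change _ ≤ (nodeDegree S i : ℝ) * _
  rw [nodeDegree_eq hS]
  exact sum_min_sq_le_card_support_mul _ (mul_nonneg (sq_nonneg _) (noiseVar_pos hS i).le)

/-- The support size of `βⁱ` is admissible, so the infimum is attained and is not the default `0` of
an empty set. -/
theorem sum_min_le_essSparsity_mul {S : Matrix (Fin p) (Fin p) ℝ} (hS : S.PosDef) (n : ℕ)
    (i : Fin p) : ∑ j : Others i, min (coef S i j ^ 2) (lam p n ^ 2 * noiseVar S i) ≤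
      essSparsity S n i * (lam p n ^ 2 * noiseVar S i) :=
  Nat.sInf_mem (s := {k : ℕ | ∑ j : Others i, min (coef S i j ^ 2) (lam p n ^ 2 * noiseVar S i) ≤
    k * (lam p n ^ 2 * noiseVar S i)}) ⟨_, sum_min_sq_le_card_support_mul _
      (mul_nonneg (sq_nonneg _) (noiseVar_pos hS i).le)⟩

/-- `ℓ₁`–`ℓ∞` duality; the normalization by `σ_V` in `eventC` can be dropped because unit variances
give `σ_V ≤ 1`. -/
theorem abs_inner_scaledNoise_le {S : Matrix (Fin p) (Fin p) ℝ} (hS : S.PosDef)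
    (hdiag : ∀ i, S i i = 1) {X : Matrix (Fin n) (Fin p) ℝ} {a : ℝ} (hC : X ∈ eventC S n a)
    (i : Fin p) (v : Others i → ℝ) :
    |inner ℝ (scaledNoise S X i) (designMap X i v)| ≤ √(1 + a) * lam p n * l1On Finset.univ v := by
  have hσ : 0 < √(noiseVar S i) := Real.sqrt_pos.2 (noiseVar_pos hS i)
  have hσ1 : √(noiseVar S i) ≤ 1 := Real.sqrt_le_one.2 ((noiseVar_le_diag hS i).trans (hdiag i).le)
  have hc : 0 ≤ √(1 + a) * lam p n := mul_nonneg (Real.sqrt_nonneg _) (Real.sqrt_nonneg _)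
  have h : ∀ j : Others i, |1 / (n : ℝ) * ∑ r, noise S X i r * X r j| ≤ √(1 + a) * lam p n := by
    intro j
    have e : 1 / (n : ℝ) * ∑ r, noise S X i r * X r j = √(noiseVar S i) *
        (1 / (n : ℝ) * ∑ r, noise S X i r / √(noiseVar S i) * X r j) := by
      rw [mul_left_comm, Finset.mul_sum (a := √(noiseVar S i))]
      congr 1
      exact Finset.sum_congr rfl fun r _ => by field_simp
    rw [e, abs_mul, abs_of_pos hσ]
    exact (mul_le_mul hσ1 (hC i j j.2).le (abs_nonneg _) zero_le_one).trans (one_mul _).le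
  rw [inner_scaledNoise_designMap, l1On, Finset.mul_sum]
  refine (Finset.abs_sum_le_sum_abs _ _).trans (Finset.sum_le_sum fun j _ => ?_)
  rw [abs_mul, mul_comm]
  exact mul_le_mul_of_nonneg_right (h j) (abs_nonneg _)

/-! ### Oracle inequalities on the events -/

theorem card_support_extendZero_restrictTo_le {i : Fin p} {m : ℕ} {B : Finset (Others i)}
    (hB : B.card ≤ m) (v : Others i → ℝ) :
    (Finset.univ.filter fun j => extendZero i (restrictTo B v) j ≠ 0).card ≤ m := by
  rw [card_support_extendZero]
  exact (card_support_restrictTo_le B v).trans hB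

theorem norm_designMap_restrictTo_le {S : Matrix (Fin p) (Fin p) ℝ} {X : Matrix (Fin n) (Fin p) ℝ}
    {s s₀ : ℕ} {θ : ℝ} (hM : X ∈ eventM S n s s₀ θ) {i : Fin p} {m : ℕ} (hm : 1 ≤ m)
    (hm' : m ≤ max s ((4 + 1) * s₀)) {B : Finset (Others i)} (hB : B.card ≤ m) (v : Others i → ℝ) :
    ‖designMap X i (restrictTo B v)‖ ≤ (1 + θ) * √(sparseMax (covSize S) m) * l2On B v := by
  have h := designSize_le_sqrt_sparseMax_mul X (card_support_extendZero_restrictTo_le hB v)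
  rw [l2On_univ_extendZero, l2On_univ_restrictTo] at h
  rw [norm_designMap]
  exact h.trans (mul_le_mul_of_nonneg_right (hM m hm hm').2.2.2 (l2On_nonneg _ _))

theorem le_norm_designMap_restrictTo {S : Matrix (Fin p) (Fin p) ℝ} {X : Matrix (Fin n) (Fin p) ℝ}
    {s s₀ : ℕ} {θ : ℝ} (hM : X ∈ eventM S n s s₀ θ) {i : Fin p} {m : ℕ} (hm : 1 ≤ m)
    (hm' : m ≤ max s ((4 + 1) * s₀)) {B : Finset (Others i)} (hB : B.card ≤ m) (v : Others i → ℝ) :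
    (1 - θ) * √(sparseMin (covSize S) m) * l2On B v ≤ ‖designMap X i (restrictTo B v)‖ := by
  have h := sqrt_sparseMin_mul_le_designSize X (card_support_extendZero_restrictTo_le hB v)
  rw [l2On_univ_extendZero, l2On_univ_restrictTo] at h
  rw [norm_designMap]
  exact (mul_le_mul_of_nonneg_right (hM m hm hm').2.1 (l2On_nonneg _ _)).trans h

theorem l2On_le_mul_norm_designMap {S : Matrix (Fin p) (Fin p) ℝ} {X : Matrix (Fin n) (Fin p) ℝ}
    {s₀ : ℕ} {θ : ℝ} (hR : X ∈ eventR S n s₀ 4 θ) {i : Fin p} {J : Finset (Others i)}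
    (hJ : J.card ≤ s₀) {v : Others i → ℝ} (hv : l1On Jᶜ v ≤ 4 * l1On J v) :
    l2On J v ≤ reConst (covSize S) s₀ 4 / (1 - θ) * ‖designMap X i v‖ := by
  rw [← l2On_map_extendZero, norm_designMap]
  refine (l2On_le_reConst_mul (designSize_nonneg X) hR.1.2.2
    (by rwa [Finset.card_map]) ?_).trans
    (mul_le_mul_of_nonneg_right hR.2.2 (designSize_nonneg _ _))
  rwa [l1On_compl_map_extendZero, l1On_map_extendZero]

/-- The coefficients outside the largest ones are negligible in the prediction norm. -/
theorem norm_designMap_tail_le {S : Matrix (Fin p) (Fin p) ℝ} (hS : S.PosDef)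
    {X : Matrix (Fin n) (Fin p) ℝ} {s₀ : ℕ} {θ : ℝ} (hθ : 0 < θ)
    (hM : X ∈ eventM S n (maxNodeDegree S) s₀ θ) {i : Fin p} {T₀ : Finset (Others i)}
    (hT₀ : IsLargestOn Finset.univ (essSparsity S n i) (coef S i) T₀) :
    ‖designMap X i (restrictTo T₀ᶜ (coef S i))‖ ≤
      (1 + θ) * √(sparseMax (covSize S) (maxNodeDegree S - essSparsity S n i)) *
        l2On T₀ᶜ (coef S i) := by
  set U := (Finset.univ.filter fun j => coef S i j ≠ 0) \ T₀ with hU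
  have hks := essSparsity_le_nodeDegree hS n i
  have hs : nodeDegree S i ≤ maxNodeDegree S := Finset.le_sup (Finset.mem_univ i)
  have hr : restrictTo T₀ᶜ (coef S i) = restrictTo U (coef S i) := by
    ext j
    by_cases hj : coef S i j = 0 <;> simp [restrictTo, hU, hj]
  have hUc : U.card ≤ maxNodeDegree S - essSparsity S n i := by
    rw [nodeDegree_eq hS] at hks hs
    exact (hT₀.card_support_sdiff_le hks).trans (Nat.sub_le_sub_right hs _)
  have hl : l2On U (coef S i) ≤ l2On T₀ᶜ (coef S i) :=
    Real.sqrt_le_sqrt <| Finset.sum_le_sum_of_subset_of_nonneg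
      (fun j hj => Finset.mem_compl.2 (Finset.mem_sdiff.1 hj).2) fun _ _ _ => sq_nonneg _
  rw [hr]
  -- `eventM` only covers `m ≥ 1`; for `m = 0` the tail itself vanishes.
  rcases Nat.eq_zero_or_pos (maxNodeDegree S - essSparsity S n i) with h0 | hpos
  · have : U = ∅ := by
      rw [← Finset.card_eq_zero]
      omega
    have h0 : restrictTo U (coef S i) = 0 := by
      ext j
      simp [restrictTo, this]
    rw [h0, map_zero, norm_zero]
    exact mul_nonneg (mul_nonneg (by linarith) (Real.sqrt_nonneg _)) (l2On_nonneg _ _)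
  · refine (norm_designMap_restrictTo_le hM hpos ((Nat.sub_le _ _).trans (le_max_left _ _))
      hUc _).trans (mul_le_mul_of_nonneg_left hl
        (mul_nonneg (by linarith) (Real.sqrt_nonneg _)))

theorem l2On_tail_le {S : Matrix (Fin p) (Fin p) ℝ} (hS : S.PosDef) (hdiag : ∀ i, S i i = 1)
    (hlam : 0 < lam p n) {i : Fin p} {T₀ : Finset (Others i)}
    (hT₀ : IsLargestOn Finset.univ (essSparsity S n i) (coef S i) T₀) :
    l2On T₀ᶜ (coef S i) ≤ lam p n * √(essSparsity S n i : ℝ) := by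
  have hv := noiseVar_pos hS i
  have hv1 : noiseVar S i ≤ 1 := (noiseVar_le_diag hS i).trans (hdiag i).le
  refine abs_le_of_sq_le_sq' ?_ (by positivity) |>.2
  rw [l2On_sq, mul_pow, Real.sq_sqrt (Nat.cast_nonneg _)]
  refine (hT₀.sum_sq_compl_le (by positivity) (sum_min_le_essSparsity_mul hS n i)).trans ?_
  rw [mul_comm]
  gcongr
  exact mul_le_of_le_one_right (sq_nonneg _) hv1

/-- Since `b - β = h - β_{T₀ᶜ}`, its square is at most `2‖h‖² + 2‖β_{T₀ᶜ}‖²`. Outside `T₀ ∪ T₁`,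
`‖h‖₂²` is at most `‖h_{T₀ᶜ}‖₁²/k`. The bias carries no factor `c`, hence the requirement `1 ≤ c`.
-/
theorem l2On_sub_le {ι : Type*} [Fintype ι] [DecidableEq ι] {b β h : ι → ℝ} {T₀ T₁ : Finset ι}
    {k : ℕ} (hh : h = b - restrictTo T₀ β) (hT₁ : IsLargestOn T₀ᶜ k h T₁) {t c D₀ D₁ : ℝ}
    (hc : 1 ≤ c) (ht : 0 ≤ t) (hk : 0 < k) (h01 : l2On (T₀ ∪ T₁) h ≤ D₀ * c * t * √(k : ℝ))
    (h1 : l1On T₀ᶜ h ≤ D₁ * c * t * k) (hβ : l2On T₀ᶜ β ≤ t * √(k : ℝ)) :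
    l2On Finset.univ (b - β) ≤ t * √(k : ℝ) * c * √(2 * D₀ ^ 2 + 2 * D₁ ^ 2 + 2) := by
  have hk' : (0 : ℝ) < k := Nat.cast_pos.2 hk
  refine abs_le_of_sq_le_sq' ?_ (by positivity) |>.2
  have hdec : ∀ j, (b - β) j ^ 2 ≤ 2 * h j ^ 2 + 2 * restrictTo T₀ᶜ β j ^ 2 := fun j => by
    by_cases hj : j ∈ T₀
    · simp only [hh, restrictTo, hj, Pi.sub_apply, if_true, Finset.mem_compl, not_true, if_false]
      nlinarith [sq_nonneg (b j - β j)]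
    · simp only [hh, restrictTo, hj, Pi.sub_apply, if_true, Finset.mem_compl, not_false_eq_true,
        if_false, sub_zero]
      nlinarith [sq_nonneg (b j + β j)]
  have hsplit : l2On Finset.univ h ^ 2 = l2On (T₀ ∪ T₁) h ^ 2 + l2On (T₀ᶜ \ T₁) h ^ 2 := by
    have : T₀ᶜ \ T₁ = (T₀ ∪ T₁)ᶜ := by ext j; simp
    rw [this, l2On_sq, l2On_sq, l2On_sq]
    exact (Finset.sum_add_sum_compl _ _).symm
  have hsum : l2On Finset.univ (b - β) ^ 2 ≤
      2 * l2On Finset.univ h ^ 2 + 2 * l2On T₀ᶜ β ^ 2 := by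
    rw [← l2On_univ_restrictTo T₀ᶜ β, l2On_sq, l2On_sq, l2On_sq, Finset.mul_sum, Finset.mul_sum,
      ← Finset.sum_add_distrib]
    exact Finset.sum_le_sum fun j _ => hdec j
  have e1 : l2On (T₀ ∪ T₁) h ^ 2 ≤ D₀ ^ 2 * c ^ 2 * t ^ 2 * k := by
    refine (pow_le_pow_left₀ (l2On_nonneg _ _) h01 2).trans_eq ?_
    rw [mul_pow, Real.sq_sqrt hk'.le]; ring
  have e2 : l2On (T₀ᶜ \ T₁) h ^ 2 ≤ D₁ ^ 2 * c ^ 2 * t ^ 2 * k := by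
    have := hT₁.mul_sq_l2On_sdiff_le.trans (pow_le_pow_left₀ (l1On_nonneg _ _) h1 2)
    refine le_of_mul_le_mul_left (this.trans_eq ?_) hk'
    ring
  have e3 : l2On T₀ᶜ β ^ 2 ≤ t ^ 2 * k := by
    refine (pow_le_pow_left₀ (l2On_nonneg _ _) hβ 2).trans_eq ?_
    rw [mul_pow, Real.sq_sqrt hk'.le]
  have e4 : t ^ 2 * k ≤ c ^ 2 * (t ^ 2 * k) :=
    le_mul_of_one_le_left (by positivity) (one_le_pow₀ hc)
  rw [mul_pow, mul_pow, mul_pow, Real.sq_sqrt hk'.le, Real.sq_sqrt (by positivity)]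
  nlinarith

theorem lam_pos {p n : ℕ} (hp : 1 < p) (hn : 0 < n) : 0 < lam p n := by
  have : 0 < Real.log p := Real.log_pos (Nat.one_lt_cast.2 hp)
  have : (0 : ℝ) < n := Nat.cast_pos.2 hn
  exact Real.sqrt_pos.2 (by positivity)

theorem SampleSize.pos {S : Matrix (Fin p) (Fin p) ℝ} {s s₀ : ℕ} {θ c' α : ℝ}
    (hn : SampleSize S n s s₀ θ c' α) (hc' : 0 < c') : 0 < n := by
  have h : 0 ≤ 9 * c' * α ^ 4 / θ ^ 2 *
      max (36 * reConst (covSize S) s₀ 4 ^ 2 * fSize S s₀) (Real.log p) :=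
    mul_nonneg (by positivity) (le_max_of_le_right (Real.log_natCast_nonneg p))
  exact Nat.cast_pos.1 ((h.trans (le_max_left _ _)).trans_lt hn)

/-- The oracle inequalities for one regression, on the events. -/
theorem nodewise_oracle_inequalities {S : Matrix (Fin p) (Fin p) ℝ} (hS : S.PosDef)
    (hdiag : ∀ i, S i i = 1) {X : Matrix (Fin n) (Fin p) ℝ} {θ a d₀ : ℝ} (hθ₀ : 0 < θ)
    (hθ₁ : θ < 1) (hlam : 0 < lam p n) (ha : 6 ≤ a) (hd₀ : 2 * (1 + θ) * √(1 + a) ≤ d₀)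
    (hRE : 0 ≤ reConst (covSize S) (maxEssSparsity S n) 4)
    (hC : X ∈ eventC S n a) (hR : X ∈ eventR S n (maxEssSparsity S n) 4 θ)
    (hM : X ∈ eventM S n (maxNodeDegree S) (maxEssSparsity S n) θ) {i : Fin p}
    {b : Others i → ℝ} (hb : IsLassoSolution X i (d₀ * lam p n) b) {T₀ : Finset (Others i)}
    (hT₀ : IsLargestOn Finset.univ (essSparsity S n i) (coef S i) T₀) {h : Others i → ℝ}
    (hh : h = b - restrictTo T₀ (coef S i)) {T₁ : Finset (Others i)}
    (hT₁ : IsLargestOn T₀ᶜ (essSparsity S n i) h T₁) {k : ℕ} (hk : k = essSparsity S n i) {D₀ D₁ : ℝ}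
    (hD₀ : D₀ = constD0 S (maxNodeDegree S) (maxEssSparsity S n) k θ d₀)
    (hD₁ : D₁ = constD1 S (maxNodeDegree S) (maxEssSparsity S n) k θ d₀) :
    l2On Finset.univ (b - coef S i) ≤
        lam p n * √(k : ℝ) * d₀ * √(2 * D₀ ^ 2 + 2 * D₁ ^ 2 + 2) ∧
      l2On (T₀ ∪ T₁) h ≤ D₀ * d₀ * lam p n * √(k : ℝ) ∧
      l1On T₀ᶜ h ≤ D₁ * d₀ * lam p n * (k : ℝ) := by
  have hks₀ : k ≤ maxEssSparsity S n := hk ▸ Finset.le_sup (Finset.mem_univ i)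
  set s := maxNodeDegree S with hs
  set s₀ := maxEssSparsity S n with hs₀
  set t := lam p n with ht
  have hsq : 1 ≤ √(1 + a) := Real.one_le_sqrt.2 (by linarith)
  have hd₁ : 1 ≤ d₀ := by nlinarith
  have hd : 0 < d₀ := by linarith
  have hlamn : 0 < d₀ * t := mul_pos hd hlam
  have htail := l2On_tail_le hS hdiag hlam hT₀
  have hρ : 0 ≤ sparseMax (covSize S) (s - k) := sparseMax_nonneg _ _
  set A : ℝ := (1 + θ) * √(sparseMax (covSize S) (s - k)) * (t * √(k : ℝ)) with hA
  have hA0 : 0 ≤ A := by positivity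
  have hAle : ‖designMap X i (restrictTo T₀ᶜ (coef S i))‖ ≤ A := by
    refine (norm_designMap_tail_le hS hθ₀ hM hT₀).trans ?_
    rw [← hk] at htail ⊢
    exact mul_le_mul_of_nonneg_left htail (by positivity)
  have hbasic := lasso_basic_inequality (L := designMap X i) (w := scaledNoise S X i)
    (β := coef S i) (b := b) (lamn := d₀ * t)
    (fun v => (abs_inner_scaledNoise_le hS hdiag hC i v).trans
      (mul_le_mul_of_nonneg_right (by
        have : √(1 + a) ≤ d₀ / 2 := by nlinarith
        nlinarith) (l1On_nonneg _ _)))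
    (by
      have := hb (restrictTo T₀ (coef S i))
      rwa [lassoObjective_eq S, lassoObjective_eq S] at this)
    hlamn.le hAle hh
  rw [← hk] at hT₀ hT₁ htail
  rcases Nat.eq_zero_or_pos k with h0 | hkpos
  -- With `k = 0` there is no bias and `T₀`, `T₁` are empty, so the basic inequality forces `h = 0`
  -- and the tail bound forces `β = 0`.
  · have hAz : A = 0 := by rw [hA, h0]; simp
    have hT₀e : T₀ = ∅ := Finset.card_eq_zero.1 (by have := hT₀.card_le; omega)
    have hT₁e : T₁ = ∅ := Finset.card_eq_zero.1 (by have := hT₁.card_le; omega)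
    subst hT₀e hT₁e
    have h1 : l1On ∅ᶜ h = 0 := by
      have e : l1On ∅ h = 0 := by simp [l1On]
      rw [hAz, e] at hbasic
      have := l1On_nonneg ∅ᶜ h
      nlinarith [sq_nonneg ‖designMap X i h‖]
    have hh0 : h = 0 := by
      ext j
      have := (Finset.sum_eq_zero_iff_of_nonneg fun j _ => abs_nonneg (h j)).1 h1 j (by simp)
      simpa using this
    have hβ : l2On Finset.univ (coef S i) = 0 := by
      refine le_antisymm ?_ (l2On_nonneg _ _)
      simpa [h0] using htail
    have hb0 : b = 0 := by
      have : h = b := by rw [hh]; ext j; simp [restrictTo]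
      rw [← this, hh0]
    refine ⟨?_, ?_, ?_⟩
    · rw [hb0, h0]
      simpa [l2On] using hβ.le
    · simp [h0, l2On]
    · rw [h1, h0]; simp
  · have hsk : 0 < √(k : ℝ) := Real.sqrt_pos.2 (Nat.cast_pos.2 hkpos)
    have hskk : √(k : ℝ) ^ 2 = k := Real.sq_sqrt (Nat.cast_nonneg k)
    have h1θ : 0 < 1 - θ := by linarith
    have h2k : 2 * k ≤ max s ((4 + 1) * s₀) := le_max_of_le_right (by omega)
    have h3k : 3 * k ≤ max s ((4 + 1) * s₀) := le_max_of_le_right (by omega)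
    have hm : 0 < (1 - θ) * √(sparseMin (covSize S) (2 * k)) := (hM _ (by omega) h2k).1
    have hmain := lasso_cone_alternative (L := designMap X i) (K := reConst (covSize S) s₀ 4 / (1 - θ))
      (R := (1 + θ) * √(sparseMax (covSize S) (3 * k))) hkpos hbasic hlamn hA0
      (div_nonneg hRE h1θ.le) hm hT₀.card_le hT₁
      (fun J hJ v hv => l2On_le_mul_norm_designMap hR (hJ.trans hks₀) hv)
      (fun B hB v => le_norm_designMap_restrictTo hM (by omega) h2k hB v)
      (fun B hB v => norm_designMap_restrictTo_le hM (by omega) h3k hB v)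
    have hρ3 : √(sparseMax (covSize S) (3 * k)) ^ 2 = sparseMax (covSize S) (3 * k) :=
      Real.sq_sqrt (sparseMax_nonneg _ _)
    have hρ2 : √(sparseMin (covSize S) (2 * k)) ^ 2 = sparseMin (covSize S) (2 * k) :=
      Real.sq_sqrt (sparseMin_nonneg _ _)
    have hρs : √(sparseMax (covSize S) (s - k)) ^ 2 = sparseMax (covSize S) (s - k) :=
      Real.sq_sqrt hρ
    have hm2 : 0 < √(sparseMin (covSize S) (2 * k)) := pos_of_mul_pos_right hm h1θ.le
    have hbounds : l2On (T₀ ∪ T₁) h ≤ D₀ * d₀ * t * √(k : ℝ) ∧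
        l1On T₀ᶜ h ≤ D₁ * d₀ * t * (k : ℝ) := by
      -- Every eigenvalue, and `k`, becomes the square of its root, so that the comparison of
      -- constants is rational in these roots.
      rw [hD₀, hD₁, constD0, constD1, constD, ← hρ3, ← hρ2, ← hρs, ← hskk]
      simp only [Real.sqrt_sq (Real.sqrt_nonneg _)]
      set K := reConst (covSize S) s₀ 4
      set ρ := √(sparseMax (covSize S) (s - k))
      set ρ' := √(sparseMax (covSize S) (3 * k))
      set m := √(sparseMin (covSize S) (2 * k))
      set q := √(k : ℝ)
      have hρ0 : 0 ≤ ρ := Real.sqrt_nonneg _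
      have hassoc : ∀ D Q : ℝ, D * d₀ * t * Q = D * (d₀ * t * Q) := fun _ _ => by ring
      rcases hmain with ⟨e1, e2⟩ | ⟨e1, e2⟩
      · constructor
        · refine e1.trans ?_
          rw [hassoc]
          refine le_trans (le_of_eq ?_)
            (mul_le_mul_of_nonneg_right (le_max_right _ _) (by positivity))
          rw [hA]
          field_simp
          ring
        · have e3 : l1On T₀ᶜ h ≤ ((3 * (d₀ * t) * q * (K / (1 - θ)) + 2 * A) / 2) ^ 2 / (d₀ * t) := by
            rw [le_div_iff₀ hlamn, mul_comm]; exact e2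
          refine e3.trans ?_
          rw [hassoc]
          refine le_trans (le_of_eq ?_)
            (mul_le_mul_of_nonneg_right (le_max_right _ _) (by positivity))
          rw [hA]
          field_simp
          ring
      · constructor
        · refine e1.trans ?_
          rw [hassoc]
          refine le_trans ?_
            (mul_le_mul_of_nonneg_right (le_max_left _ _) (by positivity))
          -- The argument gives `2` where `D` has `3`; this is the only slack in the constants of
          -- this case.
          have e3 : 2 * A / ((1 - θ) * m) ≤ 3 * A / ((1 - θ) * m) := by
            gcongr
            norm_num
          refine (add_le_add_left e3 _).trans (le_of_eq ?_)
          rw [hA]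
          field_simp
        · have e3 : l1On T₀ᶜ h ≤ 4 * A ^ 2 / (d₀ * t) := by
            rw [le_div_iff₀ hlamn, mul_comm]; exact e2
          refine e3.trans ?_
          rw [hassoc]
          refine le_trans (le_of_eq ?_)
            (mul_le_mul_of_nonneg_right (le_max_left _ _) (by positivity))
          rw [hA]
          field_simp
    exact ⟨l2On_sub_le hh hT₁ hd₁ hlam.le hkpos hbounds.1 hbounds.2 htail, hbounds⟩

end NodewiseLasso

theorem mainTheorem8
    {Ω : Type*} [MeasurableSpace Ω] (μ : Measure Ω) [IsProbabilityMeasure μ]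
    {p n : ℕ}
    -- the covariance matrix `Σ₀`, nonsingular, with unit diagonal
    (S : Matrix (Fin p) (Fin p) ℝ) (hS : S.PosDef) (hdiag : ∀ i, S i i = 1)
    -- the data: `n` i.i.d. rows with law `N_p(0, Σ₀)`
    (x : Fin n → Ω → EuclideanSpace ℝ (Fin p))
    (hlaw : ∀ r, HasLaw (x r) (multivariateGaussian 0 S) μ)
    (hindep : iIndepFun x μ)
    (X : Ω → Matrix (Fin n) (Fin p) ℝ) (hX : ∀ ω r j, X ω r j = x r ω j)
    -- maximum node degree `s` and maximum essential sparsity `s₀`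
    (s s₀ : ℕ) (hs : s = maxNodeDegree S) (hs₀ : s₀ = maxEssSparsity S n)
    (θ : ℝ) (hθ₀ : 0 < θ) (hθ₁ : θ < 1)
    (hsp : s < p)
    (hmin : 0 < sparseMin (covSize S) s)
    (hRE : RE (covSize S) s₀ 4)
    (hmax : BddAbove (sparseRatios (covSize S) (max s (3 * s₀))))
    -- the sample size condition, whatever the positive constants `c'` and `α` are
    (c' α : ℝ) (hc' : 0 < c') (hα : 0 < α)
    (hn : SampleSize S n s s₀ θ c' α)
    (a : ℝ) (ha : 6 ≤ a) (d₀ : ℝ) (hd₀ : 2 * (1 + θ) * √(1 + a) ≤ d₀) :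
    ∀ ω, X ω ∈ eventC S n a ∩ eventX S n s s₀ θ →
      ∀ i : Fin p, ∀ b : Others i → ℝ,
        IsLassoSolution (X ω) i (d₀ * lam p n) b →
      ∀ T₀ : Finset (Others i),
        IsLargestOn Finset.univ (essSparsity S n i)
          (coef S i) T₀ →
      ∀ h : Others i → ℝ,
        h = b - restrictTo T₀ (coef S i) →
      ∀ T₁ : Finset (Others i),
        IsLargestOn T₀ᶜ (essSparsity S n i) h T₁ →
      let k : ℕ := essSparsity S n i
      let lam : ℝ := lam p n
      let D₀ : ℝ := constD0 S s s₀ k θ d₀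
      let D₁ : ℝ := constD1 S s s₀ k θ d₀
      l2On Finset.univ (b - coef S i) ≤
          lam * √(k : ℝ) * d₀ * √(2 * D₀ ^ 2 + 2 * D₁ ^ 2 + 2) ∧
        l2On (T₀ ∪ T₁) h ≤ D₀ * d₀ * lam * √(k : ℝ) ∧
        l1On T₀ᶜ h = l1On T₀ᶜ b ∧
        l1On T₀ᶜ b ≤ D₁ * d₀ * lam * (k : ℝ) := by
  intro ω hω i b hb T₀ hT₀ h hh T₁ hT₁
  subst hs hs₀
  -- `1 ≤ s₀ < p` makes `log p`, and hence `λ`, positive.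
  have hp : 1 < p := hRE.1.trans_lt hRE.2.1
  obtain ⟨hC, ⟨hR, -⟩, hM⟩ := hω
  obtain ⟨h1, h2, h3⟩ := nodewise_oracle_inequalities hS hdiag hθ₀ hθ₁ (lam_pos hp (hn.pos hc'))
    ha hd₀ (inv_nonneg.2 hRE.2.2.le) hC hR hM hb hT₀ hh hT₁ rfl rfl rfl
  have heq : l1On T₀ᶜ h = l1On T₀ᶜ b := Finset.sum_congr rfl fun j hj => by
    simp [hh, restrictTo, Finset.mem_compl.1 hj]
  exact ⟨h1, h2, heq, heq ▸ h3⟩
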